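/- Let $G$ be a finite directed graph with vertex set $V(G)$ and edge set $E(G)$; loops and multiple edges are allowed. A directed cycle is a closed directed walk with at least one edge and pairwise distinct vertices (a loop is a directed cycle), taken up to cyclic rotation; $G$ is acyclic if it has no directed cycle. Let $\alpha(G)$ be the maximal number of pairwise edge-disjoint directed cycles in $G$, and $\beta(G)$ the minimal number of edges whose removal destroys all directed cycles in $G$. The graph $G$ is planar if it has a planar combinatorial embedding, i.e. a rotation system (a cyclic order of the half-edges at each non-isolated vertex) such that every connected component with at least one edge satisfies Euler's formula $v-e+f=2$, where $f$ is the number of face orbits of the rotation system on that component. For a vertex $v$, let $x_1,\dots,x_m$ be the edges with initial vertex $v$ and $y_1,\dots,y_n$ the edges with terminal vertex $v$, and put $k_v=\max\{m,n\}$. For $1\le l\le k_v$ let $$\delta_{v,l}=e_l(x_1,\dots,x_m)-e_l(y_1,\dots,y_n)\in\mathbb{Z}[E(G)],$$ where $e_l$ is the $l$-th elementary symmetric polynomial ($e_l=0$ if $l$ exceeds the number of variables). Let $I(G)$ be the ideal of $\mathbb{Z}[E(G)]$ generated by all $\delta_{v,l}$. Let $\mathscr{C}_*(G)$ be the Koszul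 chain complex over $\mathbb{Z}[E(G)]$ of the family $(\delta_{v,l})_{v\in V(G),\,1\le l\le k_v}$, listed in any order. Let $\mathscr{H}_*(G)$ be its homology (the Khovanov–Rozansky homology of $G$; in particular $\mathscr{H}_0(G)\cong\mathbb{Z}[E(G)]/I(G)$), and let $\mathscr{H}^{\mathbb{Q}}_*(G)$ be the homology of $\mathbb{Q}\otimes_{\mathbb{Z}}\mathscr{C}_*(G)$. For a module $M$ over a commutative ring $R$, let $\operatorname{Kdim}_R M$ be the Krull dimension of the ring $R/\operatorname{ann}_R(M)$. **Theorem.** 1. The following statements are equivalent: (1) $G$ is acyclic; (2) $\mathscr{H}_0(G)$ is a finitely generated $\mathbb{Z}$-module; (3) $\mathscr{H}_*(G)$ is a finitely generated $\mathbb{Z}$-module; (4) there is an $n\ge 1$ such that $x^n\in I(G)$ for all $x\in E(G)$; (5) $\operatorname{Kdim}_{\mathbb{Z}[E(G)]}\mathscr{H}_0(G)=1$; (6) $\operatorname{Kdim}_{\mathbb{Q}[E(G)]}\mathscr{H}^{\mathbb{Q}}_0(G)=0$. 2. $$\alpha(G)=\operatorname{Kdim}_{\mathbb{Q}[E(G)]}\mathscr{H}^{\mathbb{Q}}_0(G)\le\operatorname{Kdim}_{\mathbb{Z}[E(G)]}\mathscr{H}_0(G)-1\le\beta(G).$$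 In particular, if $G$ is planar, then $$\alpha(G)=\operatorname{Kdim}_{\mathbb{Q}[E(G)]}\mathscr{H}^{\mathbb{Q}}_0(G)=\operatorname{Kdim}_{\mathbb{Z}[E(G)]}\mathscr{H}_0(G)-1=\beta(G).$$ -/

import Mathlib

noncomputable section

/-- A directed multigraph with vertex set `V` and edge set `E`; loops and multiple edges are
allowed. (Finiteness is imposed by type classes where it is used.) -/
structure DirGraph (V : Type*) (E : Type*) where
  /-- the initial vertex of an edge -/
  src : E → V
  /-- the terminal vertex of an edge -/
  tgt : E → V

namespace DirGraph

section Combinatorics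

variable {V E : Type*}

/-- A directed cycle `v₀, x₀, v₁, x₁, …, vₙ, xₙ, v₀`, recorded by its edges `x₀, …, xₙ`
(so `vᵢ = src xᵢ`); the sum `i + 1` in `Fin (n + 1)` is cyclic. Loops are the case `n = 0`. -/
structure DirCycle (G : DirGraph V E) where
  /-- the cycle has `n + 1` edges -/
  n : ℕ
  /-- the edges in cyclic order -/
  edge : Fin (n + 1) → E
  /-- consecutive edges fit together -/
  tgt_eq : ∀ i, G.tgt (edge i) = G.src (edge (i + 1))
  /-- the vertices are pairwise distinct -/
  src_inj : Function.Injective fun i => G.src (edge i)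

/-- The set of edges of a directed cycle. -/
def DirCycle.edgeSet {G : DirGraph V E} (c : G.DirCycle) : Set E := Set.range c.edge

/-- A directed graph is acyclic if it contains no directed cycle. -/
def Acyclic (G : DirGraph V E) : Prop := IsEmpty G.DirCycle

/-- The graph obtained by removing the edges in `S`. -/
def deleteEdges (G : DirGraph V E) (S : Finset E) : DirGraph V {x : E // x ∉ S} where
  src x := G.src x
  tgt x := G.tgt x

/-- The cycle packing number `α(G)`: the maximal number of pairwise edge-disjoint directed
cycles. (The empty family is allowed and `k ≤ |E|` for every admissible `k`, as directed cycles
have edges; so for finite `E` this is the maximum of a nonempty bounded set. Sequences that differ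
by a rotation are never edge-disjoint, hence are not counted twice.) -/
def alpha (G : DirGraph V E) : ℕ :=
  sSup {k : ℕ | ∃ c : Fin k → G.DirCycle, Pairwise fun i j => Disjoint (c i).edgeSet (c j).edgeSet}

/-- The number `β(G)`: the minimal number of edges whose removal destroys all directed cycles. -/
def beta (G : DirGraph V E) : ℕ :=
  sInf {k : ℕ | ∃ S : Finset E, S.card = k ∧ (G.deleteEdges S).Acyclic}

/-! ### Planarity -/

/-- The vertex at which a dart (half-edge) is attached: `(x, true)` is the initial half of the
edge `x` and `(x, false)` is its terminal half. -/
def dartVertex (G : DirGraph V E) (d : E × Bool) : V :=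
  if d.2 then G.src d.1 else G.tgt d.1

/-- The involution of the darts that exchanges the two halves of every edge. -/
def flipDart (E : Type*) : Equiv.Perm (E × Bool) :=
  (Equiv.refl E).prodCongr Equiv.boolNot

/-- `σ` is a rotation system of `G`: it cyclically permutes the darts at each vertex, so that its
cycles are exactly the sets of darts at a common vertex. -/
def IsRotationSystem (G : DirGraph V E) (σ : Equiv.Perm (E × Bool)) : Prop :=
  ∀ d d' : E × Bool, σ.SameCycle d d' ↔ G.dartVertex d = G.dartVertex d'

/-- The number of cycles of a permutation, fixed points included. -/
def numCycles {D : Type*} (σ : Equiv.Perm D) : ℕ :=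
  Nat.card (Quotient (Equiv.Perm.SameCycle.setoid σ))

/-- The number of connected components having at least one edge: the number of orbits on the
darts of the group generated by the rotation system `σ` and the flip. -/
def numComponents (σ : Equiv.Perm (E × Bool)) : ℕ :=
  Nat.card (MulAction.orbitRel.Quotient (Subgroup.closure {σ, flipDart E}) (E × Bool))

/-- A (finite) graph is planar if it has a planar combinatorial embedding: a rotation system `σ`
whose faces, the cycles of `σ * flip`, satisfy Euler's formula `v - e + f = 2 c`, where `v` is
the number of non-isolated vertices (the cycles of `σ`), `e` the number of edges and `c` the number
of components having an edge. As `v - e + f ≤ 2` for every component of any rotation system, this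
says that every component is embedded in the sphere. -/
def IsPlanar (G : DirGraph V E) : Prop :=
  ∃ σ : Equiv.Perm (E × Bool), G.IsRotationSystem σ ∧
    numCycles σ + numCycles (σ * flipDart E) = Nat.card E + 2 * numComponents σ

end Combinatorics

end DirGraph

/-! ### The Koszul chain complex of a finite sequence -/

namespace Koszul

universe u

variable {R : Type u} [CommRing R] {N : ℕ} (r : Fin N → R)

/-- The standard basis of the Koszul complex in homological degree `i`: the `0/1`-sequences of
length `N` with exactly `i` ones, recorded as `i`-element subsets of `Fin N`. -/
abbrev Index (N i : ℕ) : Type := {s : Finset (Fin N) // s.card = i}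

/-- Remove an element from a subset with `i + 1` elements. -/
def Index.erase {N i : ℕ} (s : Index N (i + 1)) (j : {j // j ∈ s.1}) : Index N i :=
  ⟨s.1.erase j, by rw [Finset.card_erase_of_mem j.2, s.2]; rfl⟩

/-- The sign exponent: the number of elements of `s` before `j`. -/
def before {N : ℕ} (s : Finset (Fin N)) (j : Fin N) : ℕ := (s.filter (· < j)).card

/-- The boundary map, given on the standard basis by
`d 1_s = ∑_{j ∈ s} (-1)^{#{l ∈ s | l < j}} r_j 1_{s \ {j}}`. -/
def boundary (i : ℕ) : (Index N (i + 1) →₀ R) →ₗ[R] (Index N i →₀ R) :=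
  Finsupp.linearCombination R fun s : Index N (i + 1) =>
    ∑ j : {j // j ∈ s.1}, Finsupp.single (s.erase j) ((-1) ^ before s.1 j * r j)

theorem before_erase_of_lt {N : ℕ} {s : Finset (Fin N)} {j l : Fin N} (h : j < l) :
    before (s.erase l) j = before s j := by
  unfold before
  congr 1
  ext x
  simp only [Finset.mem_filter, Finset.mem_erase]
  constructor
  · rintro ⟨⟨-, h1⟩, h2⟩; exact ⟨h1, h2⟩
  · rintro ⟨h1, h2⟩; exact ⟨⟨(h2.trans h).ne, h1⟩, h2⟩

theorem before_erase_of_gt {N : ℕ} {s : Finset (Fin N)} {j l : Fin N} (hj : j ∈ s) (h : j < l) :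
    before (s.erase j) l + 1 = before s l := by
  unfold before
  rw [Finset.filter_erase, Finset.card_erase_add_one]
  simp [hj, h]

theorem boundary_comp (i : ℕ) : boundary r i ∘ₗ boundary r (i + 1) = 0 := by
  apply Finsupp.lhom_ext'
  intro s
  apply LinearMap.ext_ring
  simp only [boundary, LinearMap.comp_apply, Finsupp.lsingle_apply,
    Finsupp.linearCombination_single, one_smul, map_sum, Finset.smul_sum, Finsupp.smul_single,
    LinearMap.zero_apply, smul_eq_mul]
  rw [Finset.sum_sigma']
  have hmem : ∀ a : (j : {j // j ∈ s.1}) × {l // l ∈ (s.erase j).1},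
      a.2.1 ∈ s.1 ∧ a.1.1 ≠ a.2.1 := fun a =>
    ⟨Finset.mem_of_mem_erase a.2.2, (Finset.ne_of_mem_erase a.2.2).symm⟩
  refine Finset.sum_involution
    (fun a _ => ⟨⟨a.2.1, (hmem a).1⟩, ⟨a.1.1, Finset.mem_erase.2 ⟨(hmem a).2, a.1.2⟩⟩⟩)
    ?_ ?_ (fun _ _ => by simp) ?_
  · rintro ⟨⟨j, hj⟩, ⟨l, hl⟩⟩ -
    have hl' : l ∈ s.1 := Finset.mem_of_mem_erase hl
    have hne : l ≠ j := Finset.ne_of_mem_erase hl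
    have hidx : ((s.erase ⟨l, hl'⟩).erase ⟨j, Finset.mem_erase.2 ⟨hne.symm, hj⟩⟩) =
        ((s.erase ⟨j, hj⟩).erase ⟨l, hl⟩) :=
      Subtype.ext (Finset.erase_right_comm)
    dsimp only
    rw [hidx, ← Finsupp.single_add]
    refine (congrArg _ ?_).trans (Finsupp.single_zero _)
    change (-1) ^ before s.1 j * r j * ((-1) ^ before (s.1.erase j) l * r l) +
      (-1) ^ before s.1 l * r l * ((-1) ^ before (s.1.erase l) j * r j) = 0
    rcases lt_or_gt_of_ne hne with h | h
    · rw [before_erase_of_lt h, ← before_erase_of_gt hl' h]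
      ring
    · rw [before_erase_of_lt h, ← before_erase_of_gt hj h]
      ring
  · rintro a - - h
    exact (hmem a).2 (congrArg (fun b => b.1.1) h).symm
  · rintro a -
    rfl

/-- The Koszul chain complex of the sequence `r` of elements of `R`, i.e. the tensor product of the
complexes `0 → R --r_j--> R → 0`, written in its standard basis. -/
def complex : ChainComplex (ModuleCat.{u} R) ℕ :=
  ChainComplex.of (fun i => ModuleCat.of R (Index N i →₀ R))
    (fun i => ModuleCat.ofHom (boundary r i))
    (fun i => by rw [← ModuleCat.ofHom_comp, boundary_comp]; rfl)

end Koszul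

/-- The Krull dimension of an `R`-module: the Krull dimension of the ring `R / ann_R(M)`. -/
def moduleKrullDim (R : Type*) [CommRing R] (M : Type*) [AddCommGroup M] [Module R M] :
    WithBot ℕ∞ :=
  ringKrullDim (R ⧸ Module.annihilator R M)

/-! ### Incidence ideal and Khovanov–Rozansky homology -/

namespace DirGraph

universe u

variable {V : Type*} {E : Type u} [Fintype E] (G : DirGraph V E)

open Classical in
/-- The edges with initial vertex `v`. -/
def outEdges (v : V) : Finset E := Finset.univ.filter fun x => G.src x = v

open Classical in
/-- The edges with terminal vertex `v`. -/
def inEdges (v : V) : Finset E := Finset.univ.filter fun x => G.tgt x = v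

/-- The `l`-th elementary symmetric polynomial in the variables belonging to a set of edges. -/
def esymmEdges {E : Type u} (S : Finset E) (l : ℕ) : MvPolynomial E ℤ :=
  ∑ t ∈ S.powersetCard l, ∏ x ∈ t, MvPolynomial.X x

/-- The maximum `k_v` of the out-degree and the in-degree of `v`. -/
def maxDeg (v : V) : ℕ := max (G.outEdges v).card (G.inEdges v).card

/-- The index set of the incidence relations: pairs of a vertex `v` and an `l` with
`1 ≤ l ≤ k_v`, where `l` is recorded as `l - 1`. -/
abbrev RelIndex : Type _ := (v : V) × Fin (G.maxDeg v)

/-- The degree `l` incidence relation `δ_{v,l}` at `v`. -/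
def incidenceRel (a : G.RelIndex) : MvPolynomial E ℤ :=
  esymmEdges (G.outEdges a.1) (a.2 + 1) - esymmEdges (G.inEdges a.1) (a.2 + 1)

/-- The incidence ideal `I(G)` of `ℤ[E]`. -/
def incidenceIdeal : Ideal (MvPolynomial E ℤ) := Ideal.span (Set.range G.incidenceRel)

variable {G} {N : ℕ} (ord : Fin N ≃ G.RelIndex)

/-- The Khovanov–Rozansky chain complex of `G`: the Koszul complex over `ℤ[E]` of the incidence
relations, listed in the order `ord`. -/
def krComplex : ChainComplex (ModuleCat.{u} (MvPolynomial E ℤ)) ℕ :=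
  Koszul.complex fun i => G.incidenceRel (ord i)

/-- The Khovanov–Rozansky homology of `G` in homological degree `i`, a `ℤ[E]`-module. -/
abbrev krHomology (i : ℕ) : ModuleCat.{u} (MvPolynomial E ℤ) := (krComplex ord).homology i

/-- The Khovanov–Rozansky chain complex over `ℚ`: the complex `ℚ ⊗_ℤ C_*` of `ℚ[E]`-modules,
written as the extension of scalars `ℚ[E] ⊗_{ℤ[E]} C_*` (note `ℚ[E] = ℚ ⊗_ℤ ℤ[E]`). -/
def krComplexRat : ChainComplex (ModuleCat.{u} (MvPolynomial E ℚ)) ℕ :=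
  ((ModuleCat.extendScalars.{u} (MvPolynomial.map (σ := E) (Int.castRingHom ℚ))).mapHomologicalComplex
    _).obj (krComplex ord)

/-- The Khovanov–Rozansky homology of `G` over `ℚ` in homological degree `i`. -/
abbrev krHomologyRat (i : ℕ) : ModuleCat.{u} (MvPolynomial E ℚ) := (krComplexRat ord).homology i

end DirGraph

end

/-!
The zero set of the incidence ideal is an explicit union of linear spaces. Let `a` assign to every
edge an element of a field. The relations `δ_{v,l}` vanish at `a` if and only if, for every vertex
`v`, the polynomials `∏ (1 + a_x T)` over the outgoing and over the incoming edges of `v` agree, and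
by unique factorization this means that for every `b ≠ 0` the edges with `a_x = b` form a balanced
set: as many of them leave a vertex as enter it (`levelBalanced_of_edgePoly_eq`). A balanced set
of edges decomposes into directed cycles, so `a` is a combination of the indicator functions of
edge-disjoint directed cycles (`LevelBalanced.exists_cycles`). Applied to the residue fields of
`R[E]`, this says that every prime containing the incidence ideal contains the kernel of one of the
surjections `R[E] → R[t₁, …, t_k]` given by `k` disjoint cycles (`exists_ker_cycleHom_le`). Hence
`R[E] / I` has dimension `dim R + α(G)` for every nontrivial Noetherian ring `R`
(`ringKrullDim_quotient_incidenceIdealOver`); for `R = ℤ` and `R = ℚ` these are the two Krull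
dimensions in question, since the annihilator of the zeroth Koszul homology is the ideal generated
by the sequence. In particular the dimension over `ℤ` is exactly `α(G) + 1`, and `α(G) ≤ β(G)` holds
because an edge set meeting all directed cycles has a different edge in each of `α(G)` disjoint
ones.

For the finiteness conditions, Koszul homology is annihilated by the sequence
(`Koszul.mem_annihilator_homology_complex`), so it is finite over `ℤ` as soon as `ℤ[E] / I` is. If
`G` is acyclic, the origin is the only zero, so all variables are nilpotent modulo `I`, and
`ℤ[E] / I` is integral over `ℤ`. Conversely, if the zeroth homology is finite over `ℤ`, each
variable is integral over `ℤ` modulo `I`, which a directed cycle excludes (`acyclic_of_finite`).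

It remains to show `β(G) ≤ α(G)` for planar `G`. Euler's formula implies that the coboundaries of
functions on the faces are all circulations (`mem_range_coboundary_of_planar`). So directed cycles
of `G` contain directed cuts of the dual graph and vice versa, and the claim becomes the
Lucchesi–Younger theorem for the dual graph. It is proved along the lines of Lovász's argument:
a family of directed cuts covering every arc `a` at most `2 c(a)` times can be uncrossed, and the
resulting cross-free family can be split by a 2-colouring of the tree that represents it into two
families covering `a` at most `c(a)` times (`DicutSystem.Packs.exists_half`). The weighted packing
number is therefore midpoint-concave in `c`, and an induction on the support of `c` gives the
min-max equality (`DicutSystem.exists_dijoin`).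
-/

noncomputable section

universe u

/-! ### Decomposition of balanced edge sets into directed cycles -/

namespace DirGraph

section CycleDecomposition

variable {V E : Type*} {G : DirGraph V E}

theorem DirCycle.edge_injective (c : G.DirCycle) : Function.Injective c.edge :=
  fun _ _ h => c.src_inj (congrArg G.src h)

theorem DirCycle.edgeSet_nonempty (c : G.DirCycle) : c.edgeSet.Nonempty :=
  Set.range_nonempty _

/-- Follow edges until a vertex repeats: a nonempty set of edges in which every edge has a
successor contains a directed cycle. -/
theorem exists_dirCycle_subset [Finite V] {S : Set E} (hne : S.Nonempty)
    (hS : ∀ x ∈ S, ∃ y ∈ S, G.src y = G.tgt x) : ∃ c : G.DirCycle, c.edgeSet ⊆ S := by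
  classical
  let W := {v : V // ∃ x ∈ S, G.src x = v}
  choose e heS hesrc using fun v : W => v.2
  let T : W → W := fun v => ⟨G.tgt (e v), hS _ (heS v)⟩
  obtain ⟨x₀, hx₀⟩ := hne
  obtain ⟨m, n, hmn, h⟩ := Finite.exists_ne_map_eq_of_infinite
    fun n : ℕ => T^[n] ⟨G.src x₀, x₀, hx₀, rfl⟩
  wlog hlt : m < n generalizing m n
  · exact this n m hmn.symm h.symm (lt_of_le_of_ne (not_lt.1 hlt) hmn.symm)
  set w := T^[m] ⟨G.src x₀, x₀, hx₀, rfl⟩ with hw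
  have hper : Function.IsPeriodicPt T (n - m) w := by
    change T^[n - m] w = w
    rw [hw, ← Function.iterate_add_apply, Nat.sub_add_cancel hlt.le]
    exact h.symm
  obtain ⟨p, hp⟩ := Nat.exists_eq_succ_of_ne_zero
    (hper.minimalPeriod_pos (Nat.sub_pos_of_lt hlt)).ne'
  refine ⟨⟨p, fun i => e (T^[i] w), fun i => ?_, fun i j hij => ?_⟩, ?_⟩
  · have h1 : T^[((i + 1 : Fin (p + 1)) : ℕ)] w = T (T^[i] w) := by
      have h2 : ((i + 1 : Fin (p + 1)) : ℕ) = (i + 1) % Function.minimalPeriod T w := by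
        rw [hp, Fin.val_add, Nat.succ_eq_add_one, Fin.val_one', Nat.add_mod_mod]
      rw [h2, Function.iterate_mod_minimalPeriod_eq, Function.iterate_succ_apply']
    rw [h1, hesrc]
  · simp only [hesrc] at hij
    exact Fin.ext (Function.iterate_injOn_Iio_minimalPeriod
      (Set.mem_Iio.2 (by omega)) (Set.mem_Iio.2 (by omega)) (Subtype.ext hij))
  · rintro _ ⟨i, rfl⟩
    exact heS _

open Classical in
/-- A finite set of edges is balanced if at every vertex it has as many outgoing as incoming
edges. -/
def Balanced (G : DirGraph V E) (S : Finset E) : Prop :=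
  ∀ v, (S.filter fun x => G.src x = v).card = (S.filter fun x => G.tgt x = v).card

theorem Balanced.exists_dirCycle_subset [Finite V] {S : Finset E} (hS : G.Balanced S)
    (hne : S.Nonempty) : ∃ c : G.DirCycle, c.edgeSet ⊆ S := by
  classical
  refine DirGraph.exists_dirCycle_subset hne fun x hx => ?_
  have h : 0 < (S.filter fun y => G.src y = G.tgt x).card := by
    rw [hS]
    exact Finset.card_pos.2 ⟨x, Finset.mem_filter.2 ⟨hx, rfl⟩⟩
  obtain ⟨y, hy⟩ := Finset.card_pos.1 h
  exact ⟨y, (Finset.mem_filter.1 hy).1, (Finset.mem_filter.1 hy).2⟩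

/-- The edges of a directed cycle as a finite set. -/
def DirCycle.edges [DecidableEq E] (c : G.DirCycle) : Finset E := Finset.univ.image c.edge

@[simp]
theorem DirCycle.mem_edges [DecidableEq E] {c : G.DirCycle} {x : E} :
    x ∈ c.edges ↔ x ∈ c.edgeSet := by
  simp [DirCycle.edges, DirCycle.edgeSet]

theorem DirCycle.balanced_edges [DecidableEq E] (c : G.DirCycle) : G.Balanced c.edges := by
  classical
  intro v
  unfold DirCycle.edges
  rw [Finset.filter_image, Finset.filter_image, Finset.card_image_of_injective _ c.edge_injective,
    Finset.card_image_of_injective _ c.edge_injective]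
  refine (Finset.card_bij (fun i _ => i + 1) ?_ ?_ ?_).symm
  · intro i hi
    simpa [c.tgt_eq i] using hi
  · intro i _ j _ h
    exact add_right_cancel h
  · intro i hi
    refine ⟨i - 1, ?_, sub_add_cancel _ _⟩
    simpa [c.tgt_eq (i - 1)] using hi

open Classical in
/-- A labelling of the edges is level-balanced if the edges carrying any given nonzero label form
a balanced set. -/
def LevelBalanced [Fintype E] (G : DirGraph V E) {A : Type*} [Zero A] (a : E → A) : Prop :=
  ∀ b : A, b ≠ 0 → G.Balanced (Finset.univ.filter fun x => a x = b)

/-- A level-balanced labelling is a combination of the indicator functions of edge-disjoint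
directed cycles: split off a cycle inside a level set, and repeat. -/
theorem LevelBalanced.exists_cycles [Finite V] [Fintype E] {A : Type*} [Zero A] {a : E → A}
    (ha : G.LevelBalanced a) :
    ∃ (k : ℕ) (c : Fin k → G.DirCycle),
      (Pairwise fun i j => Disjoint (c i).edgeSet (c j).edgeSet) ∧
      (∀ i, ∀ x ∈ (c i).edgeSet, ∀ y ∈ (c i).edgeSet, a x = a y) ∧
      (∀ i, ∀ x ∈ (c i).edgeSet, a x ≠ 0) ∧
      ∀ x, (∀ i, x ∉ (c i).edgeSet) → a x = 0 := by
  classical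
  induction hn : (Finset.univ.filter fun x => a x ≠ 0).card using Nat.strong_induction_on
    generalizing a with
  | _ n ih =>
  subst hn
  by_cases h0 : ∀ x, a x = 0
  · exact ⟨0, Fin.elim0, fun i => i.elim0, fun i => i.elim0, fun i => i.elim0, fun x _ => h0 x⟩
  push Not at h0
  obtain ⟨x₀, hx₀⟩ := h0
  obtain ⟨C, hC⟩ := (ha (a x₀) hx₀).exists_dirCycle_subset ⟨x₀, by simp⟩
  have hC' : ∀ x ∈ C.edgeSet, a x = a x₀ := fun x hx => by simpa using hC hx
  -- Remove the cycle `C` from the support of the labelling.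
  let a' : E → A := fun x => if x ∈ C.edgeSet then 0 else a x
  have ha' : G.LevelBalanced a' := by
    intro b hb v
    by_cases hbx : b = a x₀
    · have key : ∀ f : E → V,
          ((Finset.univ.filter fun x => a x = b).filter fun x => f x = v).card =
          ((Finset.univ.filter fun x => a' x = b).filter fun x => f x = v).card +
            (C.edges.filter fun x => f x = v).card := by
        intro f
        rw [← Finset.card_union_of_disjoint]
        · congr 1
          ext x
          simp only [Finset.mem_filter, Finset.mem_univ, true_and, Finset.mem_union,
            DirCycle.mem_edges, a']
          by_cases hx : x ∈ C.edgeSet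
          · simp [hx, hC' x hx, hbx, Ne.symm hx₀]
          · simp [hx]
        · rw [Finset.disjoint_left]
          intro x hx hx'
          simp only [Finset.mem_filter, DirCycle.mem_edges, a'] at hx hx'
          simp [hx'.1, hb.symm] at hx
      have h1 := key G.src
      have h2 := key G.tgt
      have h3 := ha b hb v
      have h4 := C.balanced_edges v
      convert_to ((Finset.univ.filter fun x => a' x = b).filter fun x => G.src x = v).card =
        ((Finset.univ.filter fun x => a' x = b).filter fun x => G.tgt x = v).card
      convert_to ((Finset.univ.filter fun x => a x = b).filter fun x => G.src x = v).card =
        ((Finset.univ.filter fun x => a x = b).filter fun x => G.tgt x = v).card at h3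
      omega
    · have hl : (Finset.univ.filter fun x => a' x = b) = Finset.univ.filter fun x => a x = b := by
        ext x
        simp only [Finset.mem_filter, Finset.mem_univ, true_and, a']
        by_cases hx : x ∈ C.edgeSet
        · simp [hx, hC' x hx, hb.symm, Ne.symm hbx]
        · simp [hx]
      have h3 := ha b hb v
      convert h3 using 3
  have hlt : (Finset.univ.filter fun x => a' x ≠ 0).card <
      (Finset.univ.filter fun x => a x ≠ 0).card := by
    refine Finset.card_lt_card ⟨fun x hx => ?_, fun h => ?_⟩
    · simp only [Finset.mem_filter, Finset.mem_univ, true_and, a', ne_eq, ite_eq_left_iff,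
        not_forall] at hx ⊢
      exact hx.2
    · obtain ⟨x, hx⟩ := C.edgeSet_nonempty
      have := h (show x ∈ Finset.univ.filter fun x => a x ≠ 0 by simp [hC' x hx, hx₀])
      simp [a', hx] at this
  obtain ⟨k, c, hdisj, hconst, hne, hzero⟩ := ih _ hlt ha' rfl
  have hout : ∀ i, ∀ x ∈ (c i).edgeSet, x ∉ C.edgeSet := fun i x hx hxC =>
    hne i x hx (by simp [a', hxC])
  have haa : ∀ i, ∀ x ∈ (c i).edgeSet, a' x = a x := fun i x hx => by simp [a', hout i x hx]
  have hdC : ∀ i, Disjoint (c i).edgeSet C.edgeSet := fun i => Set.disjoint_left.2 (hout i)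
  refine ⟨k + 1, Fin.cons C c, ?_, ?_, ?_, ?_⟩
  · intro i j hij
    cases i using Fin.cases with
    | zero =>
      cases j using Fin.cases with
      | zero => exact absurd rfl hij
      | succ j => simpa using (hdC j).symm
    | succ i =>
      cases j using Fin.cases with
      | zero => simpa using hdC i
      | succ j => simpa using hdisj fun h => hij (congrArg Fin.succ h)
  · intro i
    cases i using Fin.cases with
    | zero =>
      intro x hx y hy
      rw [hC' x (by simpa using hx), hC' y (by simpa using hy)]
    | succ i =>
      intro x hx y hy
      simp only [Fin.cons_succ] at hx hy
      rw [← haa i x hx, ← haa i y hy, hconst i x hx y hy]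
  · intro i
    cases i using Fin.cases with
    | zero =>
      intro x hx
      rw [hC' x (by simpa using hx)]
      exact hx₀
    | succ i =>
      intro x hx
      simp only [Fin.cons_succ] at hx
      rw [← haa i x hx]
      exact hne i x hx
  · intro x hx
    have h1 := hx 0
    have h2 := hzero x fun i => by simpa using hx i.succ
    simpa [a', show x ∉ C.edgeSet by simpa using h1] using h2

end CycleDecomposition

section Packing

variable {V E : Type*} {G : DirGraph V E}

theorem card_le_of_disjoint_cycles [Finite E] {k : ℕ} {c : Fin k → G.DirCycle}
    (h : Pairwise fun i j => Disjoint (c i).edgeSet (c j).edgeSet) : k ≤ Nat.card E := by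
  rw [← Nat.card_fin k]
  refine Nat.card_le_card_of_injective (fun i => (c i).edge 0) fun i j hij => ?_
  by_contra hne
  exact Set.disjoint_left.1 (h hne) ⟨0, rfl⟩ ⟨0, hij.symm⟩

theorem le_alpha [Finite E] {k : ℕ} {c : Fin k → G.DirCycle}
    (h : Pairwise fun i j => Disjoint (c i).edgeSet (c j).edgeSet) : k ≤ G.alpha :=
  le_csSup ⟨Nat.card E, fun _ ⟨_, h⟩ => card_le_of_disjoint_cycles h⟩ ⟨c, h⟩

variable (G) in
theorem exists_alpha_cycles [Finite E] : ∃ c : Fin G.alpha → G.DirCycle,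
    Pairwise fun i j => Disjoint (c i).edgeSet (c j).edgeSet :=
  Nat.sSup_mem (s := {k : ℕ | ∃ c : Fin k → G.DirCycle,
      Pairwise fun i j => Disjoint (c i).edgeSet (c j).edgeSet})
    ⟨0, Fin.elim0, fun i => i.elim0⟩ ⟨Nat.card E, fun _ ⟨_, h⟩ => card_le_of_disjoint_cycles h⟩

theorem alpha_eq_zero_iff [Finite E] : G.alpha = 0 ↔ G.Acyclic := by
  constructor
  · refine fun h => ⟨fun c => ?_⟩
    have := le_alpha (c := fun _ : Fin 1 => c) fun i j hij => absurd (Subsingleton.elim i j) hij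
    omega
  · intro h
    obtain ⟨c, -⟩ := G.exists_alpha_cycles
    by_contra h0
    exact h.false (c ⟨0, Nat.pos_of_ne_zero h0⟩)

/-- Removing the edges in `S` destroys all directed cycles if and only if `S` meets each of
them. -/
theorem deleteEdges_acyclic_iff {S : Finset E} :
    (G.deleteEdges S).Acyclic ↔ ∀ c : G.DirCycle, ∃ x ∈ S, x ∈ c.edgeSet := by
  constructor
  · intro h c
    by_contra! hc
    exact h.false ⟨c.n, fun i => ⟨c.edge i, fun hi => hc _ hi ⟨i, rfl⟩⟩, c.tgt_eq, c.src_inj⟩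
  · refine fun h => ⟨fun c => ?_⟩
    obtain ⟨x, hxS, i, rfl⟩ :=
      h ⟨c.n, fun i => (c.edge i).1, c.tgt_eq, c.src_inj⟩
    exact (c.edge i).2 hxS

theorem beta_le {S : Finset E} (hS : (G.deleteEdges S).Acyclic) : G.beta ≤ S.card :=
  Nat.sInf_le ⟨S, rfl, hS⟩

variable (G) in
theorem exists_beta_edges [Finite E] :
    ∃ S : Finset E, S.card = G.beta ∧ (G.deleteEdges S).Acyclic := by
  classical
  have := Fintype.ofFinite E
  exact Nat.sInf_mem (s := {k : ℕ | ∃ S : Finset E, S.card = k ∧ (G.deleteEdges S).Acyclic})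
    ⟨_, Finset.univ, rfl, deleteEdges_acyclic_iff.2 fun c =>
      let ⟨x, hx⟩ := c.edgeSet_nonempty
      ⟨x, Finset.mem_univ x, hx⟩⟩

variable (G) in
theorem alpha_le_beta [Finite E] : G.alpha ≤ G.beta := by
  obtain ⟨c, hc⟩ := G.exists_alpha_cycles
  obtain ⟨S, hS, hac⟩ := G.exists_beta_edges
  choose x hxS hxc using fun i => deleteEdges_acyclic_iff.1 hac (c i)
  rw [← hS, ← Fintype.card_fin G.alpha, ← Finset.card_univ]
  refine Finset.card_le_card_of_injOn x (fun i _ => hxS i) fun i _ j _ hij => ?_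
  by_contra hne
  exact Set.disjoint_left.1 (hc hne) (hxc i) (hij ▸ hxc j)

end Packing

end DirGraph

/-! ### The zero set of the incidence ideal and its dimension -/

namespace DirGraph

section GeneratingFunction

variable {V E : Type*} {G : DirGraph V E}

open Polynomial in
/-- The generating polynomial `∏ (1 + a_x T)` of the elementary symmetric polynomials of the values
of `a` on `S`. -/
def edgePoly {A : Type*} [CommRing A] (S : Finset E) (a : E → A) : A[X] :=
  ∏ x ∈ S, (1 + C (a x) * X)

theorem coeff_edgePoly {A : Type*} [CommRing A] (S : Finset E) (a : E → A) (l : ℕ) :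
    (edgePoly S a).coeff l = MvPolynomial.aeval a (esymmEdges S l) := by
  classical
  simp only [edgePoly, Finset.prod_one_add, Finset.prod_mul_distrib, Finset.prod_const,
    esymmEdges, map_sum, Polynomial.finsetSum_coeff, Finset.powersetCard_eq_filter,
    Finset.sum_filter]
  refine Finset.sum_congr rfl fun t _ => ?_
  rw [← map_prod, Polynomial.coeff_C_mul_X_pow]
  by_cases h : l = t.card
  · simp [h]
  · simp [h, Ne.symm h]

variable [Fintype E]

/-- All incidence relations vanish at `a` if and only if at each vertex the outgoing and incoming
edges have the same generating polynomial. -/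
theorem aeval_incidenceRel_eq_zero_iff {A : Type*} [CommRing A] (a : E → A) :
    (∀ i, MvPolynomial.aeval a (G.incidenceRel i) = 0) ↔
      ∀ v, edgePoly (G.outEdges v) a = edgePoly (G.inEdges v) a := by
  simp only [incidenceRel, map_sub, sub_eq_zero, ← coeff_edgePoly]
  constructor
  · intro h v
    ext l
    rcases l with _ | l
    · simp [edgePoly, Polynomial.coeff_zero_eq_eval_zero, Polynomial.eval_prod]
    by_cases hl : l < G.maxDeg v
    · exact h ⟨v, l, hl⟩
    · have hl' : (G.outEdges v).card < l + 1 ∧ (G.inEdges v).card < l + 1 := by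
        unfold maxDeg at hl
        omega
      rw [coeff_edgePoly, coeff_edgePoly, esymmEdges, esymmEdges,
        Finset.powersetCard_eq_empty.2 hl'.1, Finset.powersetCard_eq_empty.2 hl'.2]
  · intro h i
    rw [h]

open Classical in
theorem levelBalanced_iff_card {A : Type*} [Zero A] {a : E → A} :
    G.LevelBalanced a ↔ ∀ v, ∀ b ≠ 0, ((G.outEdges v).filter fun x => a x = b).card =
      ((G.inEdges v).filter fun x => a x = b).card := by
  have h : ∀ (f : E → V) (v : V) (b : A),
      ((Finset.univ.filter fun x => a x = b).filter fun x => f x = v) =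
      (Finset.univ.filter fun x => f x = v).filter fun x => a x = b := fun f v b =>
    Finset.filter_comm _ _ _
  unfold LevelBalanced Balanced outEdges inEdges
  simp only [h]
  exact ⟨fun H v b hb => H b hb v, fun H b hb v => H v b hb⟩

open Classical in
theorem LevelBalanced.edgePoly_eq {A : Type*} [CommRing A] {a : E → A}
    (ha : G.LevelBalanced a) (v : V) :
    edgePoly (G.outEdges v) a = edgePoly (G.inEdges v) a := by
  have key : ∀ S : Finset E, edgePoly S a = ∏ b ∈ Finset.univ.image a,
      (1 + Polynomial.C b * Polynomial.X) ^ (S.filter fun x => a x = b).card := by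
    intro S
    rw [edgePoly, ← Finset.prod_fiberwise_of_maps_to (t := Finset.univ.image a) (g := a)
      fun x _ => Finset.mem_image_of_mem a (Finset.mem_univ x)]
    refine Finset.prod_congr rfl fun b _ => ?_
    rw [← Finset.prod_const]
    exact Finset.prod_congr rfl fun x hx => by rw [(Finset.mem_filter.1 hx).2]
  rw [key, key]
  refine Finset.prod_congr rfl fun b _ => ?_
  by_cases hb : b = 0
  · simp [hb]
  · rw [levelBalanced_iff_card.1 ha v b hb]

open Classical in
/-- Over a domain, unique factorization of the generating polynomials shows that the common zeros
of the incidence relations are the level-balanced labellings. -/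
theorem levelBalanced_of_edgePoly_eq {A : Type*} [CommRing A] [IsDomain A] {a : E → A}
    (h : ∀ v, edgePoly (G.outEdges v) a = edgePoly (G.inEdges v) a) : G.LevelBalanced a := by
  -- It suffices to treat the fraction field, where `1 + a_x T` has the root `-1 / a_x`.
  have key : ∀ (K : Type _) [Field K] [DecidableEq K] (a : E → K) (S : Finset E) (b : K), b ≠ 0 →
      (edgePoly S a).roots.count (-b⁻¹) = (S.filter fun x => a x = b).card := by
    intro K _ _ a S b hb
    have hne : ∀ x, (1 + Polynomial.C (a x) * Polynomial.X : Polynomial K) ≠ 0 := fun x h0 => by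
      simpa using congrArg (Polynomial.eval 0) h0
    rw [edgePoly, Polynomial.roots_prod _ _ (Finset.prod_ne_zero_iff.2 fun x _ => hne x),
      Multiset.count_bind, Finset.card_filter, Finset.sum]
    congr 1
    refine Multiset.map_congr rfl fun x _ => ?_
    by_cases hx : a x = 0
    · simp [hx, hb.symm]
    · rw [add_comm, ← Polynomial.C_1, Polynomial.roots_C_mul_X_add_C _ hx, mul_one,
        Multiset.count_singleton]
      simp only [neg_inj, inv_inj, eq_comm]
  rw [levelBalanced_iff_card]
  intro v b hb
  let φ := algebraMap A (FractionRing A)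
  have hφ : Function.Injective φ := IsFractionRing.injective A (FractionRing A)
  have hmap : ∀ S : Finset E, edgePoly S (φ ∘ a) = (edgePoly S a).map φ := by
    intro S
    simp [edgePoly, Polynomial.map_prod]
  have h1 : ∀ S : Finset E, (S.filter fun x => a x = b) = S.filter fun x => (φ ∘ a) x = φ b :=
    fun S => Finset.filter_congr fun x _ => hφ.eq_iff.symm
  have hb' : φ b ≠ 0 := (map_ne_zero_iff φ hφ).2 hb
  rw [h1, h1, ← key _ (φ ∘ a) _ _ hb', ← key _ (φ ∘ a) _ _ hb', hmap, hmap, h v]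

end GeneratingFunction

section Dimension

variable {V E : Type*} [Fintype E] {G : DirGraph V E}

variable (G) in
/-- The incidence ideal over a base ring `R`: the extension of `I(G)` to `R[E]`. -/
def incidenceIdealOver (R : Type*) [CommRing R] : Ideal (MvPolynomial E R) :=
  G.incidenceIdeal.map (MvPolynomial.map (Int.castRingHom R))

theorem incidenceIdealOver_int : G.incidenceIdealOver ℤ = G.incidenceIdeal := by
  have : MvPolynomial.map (σ := E) (Int.castRingHom ℤ) = RingHom.id _ := by
    ext <;> simp
  rw [incidenceIdealOver, this, Ideal.map_id]

/-- A ring homomorphism from `R[E]` kills the incidence ideal if and only if the images of the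
variables satisfy the incidence relations. -/
theorem incidenceIdealOver_le_ker_iff {R A : Type*} [CommRing R] [CommRing A]
    (φ : MvPolynomial E R →+* A) :
    G.incidenceIdealOver R ≤ RingHom.ker φ ↔
      ∀ v, edgePoly (G.outEdges v) (fun x => φ (MvPolynomial.X x)) =
        edgePoly (G.inEdges v) (fun x => φ (MvPolynomial.X x)) := by
  rw [← aeval_incidenceRel_eq_zero_iff, incidenceIdealOver, Ideal.map_le_iff_le_comap,
    incidenceIdeal, Ideal.span_le, Set.range_subset_iff]
  have : ∀ p, φ (MvPolynomial.map (Int.castRingHom R) p) =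
      MvPolynomial.aeval (fun x => φ (MvPolynomial.X x)) p := by
    intro p
    have : φ.comp (MvPolynomial.map (Int.castRingHom R)) =
        (MvPolynomial.aeval (R := ℤ) fun x => φ (MvPolynomial.X x)).toRingHom := by
      ext <;> simp
    exact congrArg (fun f => f p) this
  simp only [SetLike.mem_coe, Ideal.mem_comap, RingHom.mem_ker, this]

end Dimension

section CycleHom

variable {V E : Type*} {G : DirGraph V E}

open Classical in
/-- For a family of disjoint directed cycles, the homomorphism `R[E] → R[t₁, …, t_k]` that sends
the edges of the `i`-th cycle to `t_i` and the remaining edges to `0`. Geometrically, this is the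
inclusion of the linear space spanned by the indicator functions of the cycles. -/
def cycleHom (R : Type*) [CommRing R] {k : ℕ} (c : Fin k → G.DirCycle) :
    MvPolynomial E R →ₐ[R] MvPolynomial (Fin k) R :=
  MvPolynomial.aeval fun x =>
    if h : ∃ i, x ∈ (c i).edgeSet then MvPolynomial.X h.choose else 0

variable {R : Type*} [CommRing R] {k : ℕ} {c : Fin k → G.DirCycle}

theorem cycleHom_X_of_mem (hc : Pairwise fun i j => Disjoint (c i).edgeSet (c j).edgeSet)
    {i : Fin k} {x : E} (hx : x ∈ (c i).edgeSet) :
    cycleHom R c (MvPolynomial.X x) = MvPolynomial.X i := by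
  have h : ∃ i, x ∈ (c i).edgeSet := ⟨i, hx⟩
  have : h.choose = i := by
    by_contra hne
    exact Set.disjoint_left.1 (hc hne) h.choose_spec hx
  rw [cycleHom, MvPolynomial.aeval_X, dif_pos h, this]

theorem cycleHom_X_of_notMem {x : E} (hx : ∀ i, x ∉ (c i).edgeSet) :
    cycleHom R c (MvPolynomial.X x) = 0 := by
  rw [cycleHom, MvPolynomial.aeval_X, dif_neg (by simpa using hx)]

theorem cycleHom_surjective (hc : Pairwise fun i j => Disjoint (c i).edgeSet (c j).edgeSet) :
    Function.Surjective (cycleHom R c) := by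
  rw [← AlgHom.range_eq_top, ← top_le_iff, ← MvPolynomial.adjoin_range_X, Algebra.adjoin_le_iff]
  rintro _ ⟨i, rfl⟩
  exact ⟨_, cycleHom_X_of_mem hc (Set.mem_range_self (0 : Fin ((c i).n + 1)))⟩

theorem ringKrullDim_quotient_ker_cycleHom [IsNoetherianRing R]
    (hc : Pairwise fun i j => Disjoint (c i).edgeSet (c j).edgeSet) :
    ringKrullDim (MvPolynomial E R ⧸ RingHom.ker (cycleHom R c)) = ringKrullDim R + k := by
  rw [ringKrullDim_eq_of_ringEquiv
    (Ideal.quotientKerAlgEquivOfSurjective (cycleHom_surjective hc)).toRingEquiv]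
  simp

variable [Fintype E]

theorem levelBalanced_cycleHom [Nontrivial R]
    (hc : Pairwise fun i j => Disjoint (c i).edgeSet (c j).edgeSet) :
    G.LevelBalanced fun x => cycleHom R c (MvPolynomial.X x) := by
  classical
  intro b hb
  by_cases h : ∃ i, b = MvPolynomial.X i
  · obtain ⟨i, rfl⟩ := h
    convert (c i).balanced_edges using 1
    ext x
    simp only [Finset.mem_filter, Finset.mem_univ, true_and, DirCycle.mem_edges]
    constructor
    · intro hx
      by_cases h : ∃ j, x ∈ (c j).edgeSet
      · obtain ⟨j, hj⟩ := h
        rw [cycleHom_X_of_mem hc hj] at hx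
        rwa [← MvPolynomial.X_injective hx]
      · rw [cycleHom_X_of_notMem (by simpa using h)] at hx
        exact absurd hx.symm (MvPolynomial.X_ne_zero i)
    · exact cycleHom_X_of_mem hc
  · have : (Finset.univ.filter fun x => cycleHom R c (MvPolynomial.X x) = b) = ∅ := by
      refine Finset.filter_eq_empty_iff.2 fun x _ hx => ?_
      by_cases hj : ∃ j, x ∈ (c j).edgeSet
      · obtain ⟨j, hj⟩ := hj
        exact h ⟨j, by rw [← hx, cycleHom_X_of_mem hc hj]⟩
      · rw [cycleHom_X_of_notMem (by simpa using hj)] at hx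
        exact hb hx.symm
    intro v
    simp [this]

theorem incidenceIdealOver_le_ker_cycleHom [Nontrivial R]
    (hc : Pairwise fun i j => Disjoint (c i).edgeSet (c j).edgeSet) :
    G.incidenceIdealOver R ≤ RingHom.ker (cycleHom R c) := by
  let φ : MvPolynomial E R →+* MvPolynomial (Fin k) R := cycleHom R c
  have h : G.LevelBalanced fun x => φ (MvPolynomial.X x) := levelBalanced_cycleHom hc
  exact (incidenceIdealOver_le_ker_iff φ).2 h.edgePoly_eq

/-- The zero set of the incidence ideal is the union of the linear spaces spanned by the indicator
functions of disjoint directed cycles. -/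
theorem exists_ker_cycleHom_le [Finite V] {p : Ideal (MvPolynomial E R)} [p.IsPrime]
    (hp : G.incidenceIdealOver R ≤ p) :
    ∃ (k : ℕ) (c : Fin k → G.DirCycle),
      (Pairwise fun i j => Disjoint (c i).edgeSet (c j).edgeSet) ∧
        RingHom.ker (cycleHom R c) ≤ p := by
  have h := (incidenceIdealOver_le_ker_iff (Ideal.Quotient.mk p)).1 (by rwa [Ideal.mk_ker])
  obtain ⟨k, c, hc, hconst, -, hzero⟩ := (levelBalanced_of_edgePoly_eq h).exists_cycles
  refine ⟨k, c, hc, ?_⟩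
  -- The quotient map factors through `cycleHom`.
  let s : MvPolynomial (Fin k) R →ₐ[R] MvPolynomial E R ⧸ p :=
    MvPolynomial.aeval fun i => Ideal.Quotient.mk p (MvPolynomial.X ((c i).edge 0))
  have hs : s.comp (cycleHom R c) = Ideal.Quotient.mkₐ R p := by
    ext x
    rw [AlgHom.comp_apply, Ideal.Quotient.mkₐ_eq_mk]
    by_cases h : ∃ i, x ∈ (c i).edgeSet
    · obtain ⟨i, hi⟩ := h
      rw [cycleHom_X_of_mem hc hi]
      simp only [s, MvPolynomial.aeval_X]
      exact hconst i _ ⟨0, rfl⟩ x hi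
    · rw [cycleHom_X_of_notMem (by simpa using h), map_zero]
      exact (hzero x (by simpa using h)).symm
  intro f hf
  rw [← Ideal.Quotient.eq_zero_iff_mem, ← Ideal.Quotient.mkₐ_eq_mk R, ← hs, AlgHom.comp_apply,
    RingHom.mem_ker.1 hf, map_zero]

/-- The zero set of the incidence ideal is a union of linear spaces, the largest of which has
dimension `α(G)`. -/
theorem ringKrullDim_quotient_incidenceIdealOver [Finite V] [IsNoetherianRing R] [Nontrivial R] :
    ringKrullDim (MvPolynomial E R ⧸ G.incidenceIdealOver R) = ringKrullDim R + G.alpha := by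
  apply le_antisymm
  · rw [ringKrullDim_quotient]
    refine iSup_le fun q => ?_
    obtain ⟨k, c, hc, hle⟩ := exists_ker_cycleHom_le (p := q.head.1.asIdeal) q.head.2
    refine le_trans ?_ (add_le_add_right (Nat.cast_le.2 (le_alpha hc)) _)
    rw [← ringKrullDim_quotient_ker_cycleHom hc, ringKrullDim_quotient]
    -- A chain of primes starting above the kernel of `cycleHom` is a chain in its zero locus.
    let q' : LTSeries (PrimeSpectrum.zeroLocus
        (RingHom.ker (cycleHom R c) : Set (MvPolynomial E R))) :=
      { length := q.length
        toFun := fun i => ⟨(q i).1, hle.trans (q.monotone (Fin.zero_le i))⟩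
        step := fun i => q.step i }
    exact Order.LTSeries.length_le_krullDim q'
  · obtain ⟨c, hc⟩ := G.exists_alpha_cycles
    rw [← ringKrullDim_quotient_ker_cycleHom hc]
    exact ringKrullDim_le_of_surjective
      (Ideal.Quotient.factor (incidenceIdealOver_le_ker_cycleHom hc))
      (Ideal.Quotient.factor_surjective _)

end CycleHom

end DirGraph

/-! ### Annihilators of Koszul homology -/

section HomologyOfModules

open CategoryTheory

variable {R : Type u} [CommRing R]

/-- Homology as cycles modulo boundaries: existence of a surjection from the cycles whose kernel
consists of the boundaries. -/
theorem CategoryTheory.ShortComplex.exists_cycles_surjective_homology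
    (S : ShortComplex (ModuleCat.{u} R)) :
    ∃ π : LinearMap.ker S.g.hom →ₗ[R] S.homology, Function.Surjective π ∧
      ∀ z, π z = 0 ↔ (z : S.X₂) ∈ LinearMap.range S.f.hom := by
  let e : S.homology ≃ₗ[R] LinearMap.ker S.g.hom ⧸ LinearMap.range S.moduleCatToCycles :=
    S.moduleCatHomologyIso.toLinearEquiv
  refine ⟨e.symm.toLinearMap ∘ₗ (LinearMap.range S.moduleCatToCycles).mkQ,
    e.symm.surjective.comp (Submodule.mkQ_surjective _), fun z => ?_⟩
  rw [LinearMap.comp_apply, LinearEquiv.coe_coe, LinearEquiv.map_eq_zero_iff,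
    Submodule.mkQ_apply, Submodule.Quotient.mk_eq_zero]
  constructor
  · rintro ⟨y, rfl⟩
    exact ⟨y, rfl⟩
  · rintro ⟨y, hy⟩
    exact ⟨y, Subtype.ext hy⟩

theorem exists_cycles_surjective_homology (K : ChainComplex (ModuleCat.{u} R) ℕ) (i : ℕ) :
    ∃ (Z : Submodule R (K.X i)) (π : Z →ₗ[R] K.homology i), Function.Surjective π ∧
      (∀ z, π z = 0 ↔ (z : K.X i) ∈ LinearMap.range (K.d (i + 1) i).hom) ∧
      ∀ z, z ∈ Z ↔ ∀ j, (K.d i j).hom z = 0 := by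
  obtain ⟨π, hπ, hker⟩ := (K.sc i).exists_cycles_surjective_homology
  refine ⟨LinearMap.ker (K.d i ((ComplexShape.down ℕ).next i)).hom, π, hπ, fun z => ?_,
    fun z => ?_⟩
  · have hr : ∀ j, j = i + 1 →
        LinearMap.range (K.d j i).hom = LinearMap.range (K.d (i + 1) i).hom := by
      rintro _ rfl
      rfl
    rw [← hr _ (ChainComplex.prev ℕ i)]
    exact hker z
  · constructor
    · intro hz j
      by_cases hj : (ComplexShape.down ℕ).Rel i j
      · obtain rfl := (ComplexShape.down ℕ).next_eq' hj
        exact hz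
      · rw [K.shape i j hj]
        rfl
    · intro h
      exact h _

theorem homology_finite [IsNoetherianRing R] (K : ChainComplex (ModuleCat.{u} R) ℕ) (i : ℕ)
    [Module.Finite R (K.X i)] : Module.Finite R (K.homology i) := by
  obtain ⟨Z, π, hπ, -⟩ := exists_cycles_surjective_homology K i
  exact Module.Finite.of_surjective π hπ

theorem homology_subsingleton (K : ChainComplex (ModuleCat.{u} R) ℕ) (i : ℕ)
    [Subsingleton (K.X i)] : Subsingleton (K.homology i) := by
  obtain ⟨Z, π, hπ, -⟩ := exists_cycles_surjective_homology K i
  exact hπ.subsingleton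

theorem mem_annihilator_homology (K : ChainComplex (ModuleCat.{u} R) ℕ) (i : ℕ) (a : R) :
    a ∈ Module.annihilator R (K.homology i) ↔
      ∀ z : K.X i, (∀ j, (K.d i j).hom z = 0) →
        a • z ∈ LinearMap.range (K.d (i + 1) i).hom := by
  obtain ⟨Z, π, hπ, hker, hZ⟩ := exists_cycles_surjective_homology K i
  rw [Module.mem_annihilator]
  constructor
  · intro h z hz
    have := h (π ⟨z, (hZ z).2 hz⟩)
    rw [← map_smul, hker] at this
    exact this
  · intro h m
    obtain ⟨z, rfl⟩ := hπ m
    rw [← map_smul, hker]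
    exact h z ((hZ z).1 z.2)

theorem mem_annihilator_homology_zero (K : ChainComplex (ModuleCat.{u} R) ℕ) (a : R) :
    a ∈ Module.annihilator R (K.homology 0) ↔
      ∀ z : K.X 0, a • z ∈ LinearMap.range (K.d 1 0).hom := by
  rw [mem_annihilator_homology]
  refine forall_congr' fun z => ⟨fun h => h fun j => ?_, fun h _ => h⟩
  rw [K.shape 0 j (by simp)]
  rfl

end HomologyOfModules

namespace Koszul

open CategoryTheory
open scoped ChangeOfRings

variable {R : Type u} [CommRing R] {N : ℕ} (r : Fin N → R)

theorem complex_d (i : ℕ) : (complex r).d (i + 1) i = ModuleCat.ofHom (boundary r i) :=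
  ChainComplex.of_d (fun i => ModuleCat.of R (Index N i →₀ R))
    (fun i => ModuleCat.ofHom (boundary r i)) i

/-- The Koszul differential on the free module on all subsets, regardless of degree. -/
def totalBoundary : (Finset (Fin N) →₀ R) →ₗ[R] (Finset (Fin N) →₀ R) :=
  Finsupp.linearCombination R fun s =>
    ∑ j ∈ s, Finsupp.single (s.erase j) ((-1) ^ before s j * r j)

/-- Exterior multiplication by the `j`-th basis vector on the free module on all subsets. -/
def totalInsert (R : Type u) [CommRing R] (j : Fin N) :
    (Finset (Fin N) →₀ R) →ₗ[R] (Finset (Fin N) →₀ R) :=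
  Finsupp.linearCombination R fun s =>
    if j ∈ s then 0 else Finsupp.single (insert j s) ((-1) ^ before s j)

theorem totalBoundary_single (s : Finset (Fin N)) (a : R) :
    totalBoundary r (Finsupp.single s a) =
      ∑ j ∈ s, Finsupp.single (s.erase j) (a * ((-1) ^ before s j * r j)) := by
  simp only [totalBoundary, Finsupp.linearCombination_single, Finset.smul_sum, Finsupp.smul_single,
    smul_eq_mul]

theorem totalInsert_single (j : Fin N) (s : Finset (Fin N)) (a : R) :
    totalInsert R j (Finsupp.single s a) =
      if j ∈ s then 0 else Finsupp.single (insert j s) (a * (-1) ^ before s j) := by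
  rw [totalInsert, Finsupp.linearCombination_single]
  split_ifs <;> simp

theorem before_insert_self {s : Finset (Fin N)} {j : Fin N} :
    before (insert j s) j = before s j := by
  unfold before
  congr 1
  ext x
  simp only [Finset.mem_filter, Finset.mem_insert]
  exact ⟨fun ⟨h1, h2⟩ => ⟨h1.resolve_left h2.ne, h2⟩, fun ⟨h1, h2⟩ => ⟨Or.inr h1, h2⟩⟩

/-- Exterior multiplication by the `j`-th basis vector is a homotopy from multiplication by `r j`
to zero. -/
theorem totalBoundary_totalInsert_add (j : Fin N) (z : Finset (Fin N) →₀ R) :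
    totalBoundary r (totalInsert R j z) + totalInsert R j (totalBoundary r z) = r j • z := by
  induction z using Finsupp.induction_linear with
  | zero => simp
  | add x y hx hy =>
    rw [smul_add, ← hx, ← hy]
    simp only [map_add]
    abel
  | single s a =>
    rw [totalBoundary_single, map_sum, totalInsert_single, Finsupp.smul_single, smul_eq_mul]
    simp only [totalInsert_single]
    have hsq : ∀ n, ((-1 : R) ^ n) * (-1) ^ n = 1 := fun n => by
      rw [← mul_pow]
      simp
    by_cases hj : j ∈ s
    · rw [if_pos hj, map_zero, zero_add, Finset.sum_eq_single_of_mem j hj]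
      · rw [if_neg (Finset.notMem_erase j s), Finset.insert_erase hj, mul_assoc, mul_right_comm,
          ← before_insert_self (s := s.erase j), Finset.insert_erase hj, hsq, one_mul, mul_comm]
      · intro l hl hlj
        rw [if_pos (Finset.mem_erase.2 ⟨hlj.symm, hj⟩)]
    · rw [if_neg hj, totalBoundary_single, Finset.sum_insert hj, Finset.erase_insert hj,
        before_insert_self, add_assoc, ← Finset.sum_add_distrib, Finset.sum_eq_zero, add_zero]
      · congr 1
        rw [mul_assoc, ← mul_assoc ((-1) ^ before s j), hsq, one_mul, mul_comm]
      · intro l hl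
        have hlj : l ≠ j := fun h => hj (h ▸ hl)
        rw [if_neg fun h => hj (Finset.mem_of_mem_erase h),
          Finset.erase_insert_of_ne hlj.symm, ← Finsupp.single_add]
        refine (congrArg _ ?_).trans (Finsupp.single_zero _)
        have hji : j ∈ insert j s := Finset.mem_insert_self j s
        have hli : l ∈ insert j s := Finset.mem_insert_of_mem hl
        have he : (insert j s).erase j = s := Finset.erase_insert hj
        rcases lt_or_gt_of_ne hlj with h | h
        · have h1 := before_erase_of_gt hl h
          have h2 := before_erase_of_lt (s := insert j s) h
          rw [he] at h2
          rw [← h2, ← h1]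
          ring
        · have h1 := before_erase_of_gt hji h
          have h2 := before_erase_of_lt (s := s) h
          rw [he] at h1
          rw [← h1, h2]
          ring

/-- The inclusion of the degree `i` part into the free module on all subsets. -/
def toTotal (R : Type u) [CommRing R] (i : ℕ) : (Index N i →₀ R) →ₗ[R] (Finset (Fin N) →₀ R) :=
  Finsupp.lmapDomain R R Subtype.val

theorem toTotal_injective (i : ℕ) : Function.Injective (toTotal (N := N) R i) :=
  Finsupp.mapDomain_injective Subtype.val_injective

theorem toTotal_single (i : ℕ) (s : Index N i) (a : R) :
    toTotal R i (Finsupp.single s a) = Finsupp.single s.1 a :=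
  Finsupp.mapDomain_single

theorem boundary_single (i : ℕ) (s : Index N (i + 1)) (a : R) :
    boundary r i (Finsupp.single s a) =
      ∑ j : {j // j ∈ s.1}, Finsupp.single (s.erase j) (a * ((-1) ^ before s.1 j * r j)) := by
  simp only [boundary, Finsupp.linearCombination_single, Finset.smul_sum, Finsupp.smul_single,
    smul_eq_mul]

theorem toTotal_boundary (i : ℕ) (z : Index N (i + 1) →₀ R) :
    toTotal R i (boundary r i z) = totalBoundary r (toTotal R (i + 1) z) := by
  induction z using Finsupp.induction_linear with
  | zero => simp
  | add x y hx hy => rw [map_add, map_add, map_add, map_add, hx, hy]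
  | single s a =>
    rw [boundary_single, map_sum, toTotal_single, totalBoundary_single, ← Finset.sum_coe_sort s.1]
    exact Finset.sum_congr rfl fun j _ => toTotal_single _ _ _

theorem totalBoundary_toTotal_zero (z : Index N 0 →₀ R) :
    totalBoundary r (toTotal R 0 z) = 0 := by
  induction z using Finsupp.induction_linear with
  | zero => simp
  | add x y hx hy => rw [map_add, map_add, hx, hy, add_zero]
  | single s a =>
    rw [toTotal_single, totalBoundary_single, Finset.card_eq_zero.1 s.2, Finset.sum_empty]

theorem exists_toTotal_eq_totalInsert (i : ℕ) (j : Fin N) (z : Index N i →₀ R) :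
    ∃ w : Index N (i + 1) →₀ R, toTotal R (i + 1) w = totalInsert R j (toTotal R i z) := by
  induction z using Finsupp.induction_linear with
  | zero => exact ⟨0, by simp⟩
  | add x y hx hy =>
    obtain ⟨w, hw⟩ := hx
    obtain ⟨w', hw'⟩ := hy
    exact ⟨w + w', by rw [map_add, map_add, map_add, hw, hw']⟩
  | single s a =>
    rw [toTotal_single, totalInsert_single]
    by_cases hj : j ∈ s.1
    · exact ⟨0, by simp [hj]⟩
    · refine ⟨Finsupp.single ⟨insert j s.1, by rw [Finset.card_insert_of_notMem hj, s.2]⟩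
        (a * (-1) ^ before s.1 j), ?_⟩
      rw [toTotal_single, if_neg hj]

theorem exists_boundary_eq_smul (i : ℕ) (j : Fin N) (z : Index N i →₀ R)
    (hz : totalBoundary r (toTotal R i z) = 0) : ∃ w, boundary r i w = r j • z := by
  obtain ⟨w, hw⟩ := exists_toTotal_eq_totalInsert i j z
  refine ⟨w, toTotal_injective i ?_⟩
  rw [toTotal_boundary, map_smul, ← totalBoundary_totalInsert_add, hz, map_zero, add_zero, hw]

/-- Koszul homology is annihilated by the elements of the sequence. -/
theorem mem_annihilator_homology_complex (i : ℕ) (j : Fin N) :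
    r j ∈ Module.annihilator R ((complex r).homology i) := by
  rw [mem_annihilator_homology]
  intro z hz
  rw [complex_d]
  refine exists_boundary_eq_smul r i j z ?_
  cases i with
  | zero => exact totalBoundary_toTotal_zero r z
  | succ i =>
    have h := hz i
    rw [complex_d] at h
    exact (toTotal_boundary r i z).symm.trans ((congrArg (toTotal R i) h).trans (map_zero _))

instance (i : ℕ) : Module.Finite R ((complex r).X i) :=
  inferInstanceAs (Module.Finite R (Index N i →₀ R))

theorem subsingleton_complex_X {i : ℕ} (hi : N < i) : Subsingleton ((complex r).X i) := by
  have : IsEmpty (Index N i) := ⟨fun s => by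
    have := s.1.card_le_univ
    rw [s.2, Fintype.card_fin] at this
    omega⟩
  exact inferInstanceAs (Subsingleton (Index N i →₀ R))

/-- The empty subset, the basis vector in degree `0`. -/
def emptyIndex (N : ℕ) : Index N 0 := ⟨∅, rfl⟩

theorem coeff_boundary_zero_mem (z : Index N 1 →₀ R) :
    boundary r 0 z (emptyIndex N) ∈ Ideal.span (Set.range r) := by
  induction z using Finsupp.induction_linear with
  | zero => simp
  | add x y hx hy =>
    rw [map_add, Finsupp.add_apply]
    exact add_mem hx hy
  | single s a =>
    rw [boundary_single, Finsupp.finsetSum_apply]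
    refine sum_mem fun j _ => ?_
    rw [Finsupp.single_apply]
    split_ifs
    · rw [← mul_assoc]
      exact Ideal.mul_mem_left _ _ (Ideal.subset_span ⟨_, rfl⟩)
    · exact zero_mem _

/-- The annihilator of the zeroth Koszul homology `R / (r)`. -/
theorem annihilator_homology_zero :
    Module.annihilator R ((complex r).homology 0) = Ideal.span (Set.range r) := by
  apply le_antisymm
  · intro a ha
    rw [mem_annihilator_homology_zero, complex_d] at ha
    obtain ⟨y, hy⟩ := ha (Finsupp.single (emptyIndex N) (1 : R) : Index N 0 →₀ R)
    have h := coeff_boundary_zero_mem r y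
    have h2 : boundary r 0 y = a • Finsupp.single (emptyIndex N) (1 : R) := hy
    rw [h2] at h
    simpa using h
  · rw [Ideal.span_le]
    rintro _ ⟨j, rfl⟩
    exact mem_annihilator_homology_complex r 0 j

/-- The annihilator of the zeroth homology of the Koszul complex after a base change. -/
theorem annihilator_homology_zero_extendScalars {S : Type u} [CommRing S] (f : R →+* S) :
    Module.annihilator S ((((ModuleCat.extendScalars.{u} f).mapHomologicalComplex _).obj
      (complex r)).homology 0) = (Ideal.span (Set.range r)).map f := by
  let D := ((ModuleCat.extendScalars.{u} f).mapHomologicalComplex (ComplexShape.down ℕ)).obj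
    (complex r)
  set I := Ideal.span (Set.range r) with hI
  apply le_antisymm
  · intro a ha
    rw [mem_annihilator_homology_zero] at ha
    -- The functional `s ⊗ z ↦ s z_∅` with values in `S / I S` vanishes on the boundaries.
    let φ : (complex r).X 0 ⟶ (ModuleCat.restrictScalars f).obj (ModuleCat.of S (S ⧸ I.map f)) :=
      ModuleCat.ofHom (Y := (ModuleCat.restrictScalars f).obj (ModuleCat.of S (S ⧸ I.map f)))
        { toFun := fun z : Index N 0 →₀ R => Ideal.Quotient.mk (I.map f) (f (z (emptyIndex N)))
          map_add' := fun x y => by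
            rw [Finsupp.add_apply, map_add, map_add]
            rfl
          map_smul' := fun c x => by
            change Ideal.Quotient.mk (I.map f) (f (c * x (emptyIndex N))) =
              f c • Ideal.Quotient.mk (I.map f) (f (x (emptyIndex N)))
            rw [map_mul, map_mul]
            rfl }
    have hφ : (complex r).d 1 0 ≫ φ = 0 := by
      ext z
      rw [complex_d]
      change Ideal.Quotient.mk (I.map f) (f (boundary r 0 z (emptyIndex N))) = 0
      rw [Ideal.Quotient.eq_zero_iff_mem]
      exact Ideal.mem_map_of_mem f (coeff_boundary_zero_mem r z)
    let adj := ModuleCat.extendRestrictScalarsAdj.{u} f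
    let ψ : D.X 0 ⟶ ModuleCat.of S (S ⧸ I.map f) := (adj.homEquiv _ _).symm φ
    have hψ1 : ∀ m, ψ.hom ((1 : S) ⊗ₜ[R, f] m) = φ.hom m := fun m =>
      (ModuleCat.extendRestrictScalarsAdj_homEquiv_apply (f := f) ψ m).symm.trans
        (congrArg (fun g => g.hom m) ((adj.homEquiv _ _).apply_symm_apply φ))
    have hψ : D.d 1 0 ≫ ψ = 0 := by
      apply ModuleCat.ExtendScalars.hom_ext
      intro m
      exact (hψ1 _).trans (congrArg (fun g => g.hom m) hφ)
    let e : (complex r).X 0 := (Finsupp.single (emptyIndex N) (1 : R) : Index N 0 →₀ R)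
    let e' : D.X 0 := (1 : S) ⊗ₜ[R, f] e
    have he : ψ.hom e' = Ideal.Quotient.mk (I.map f) 1 := by
      refine (hψ1 e).trans ?_
      change Ideal.Quotient.mk (I.map f)
        (f ((Finsupp.single (emptyIndex N) (1 : R) : Index N 0 →₀ R) (emptyIndex N))) = _
      rw [Finsupp.single_eq_same, map_one]
    obtain ⟨y, hy⟩ := ha e'
    have h1 : ψ.hom ((D.d 1 0).hom y) = 0 := congrArg (fun g => g.hom y) hψ
    have h2 : ψ.hom (a • e') = 0 := by
      rw [← h1]
      exact congrArg ψ.hom hy.symm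
    rw [map_smul, he] at h2
    rw [← Ideal.Quotient.eq_zero_iff_mem, ← h2]
    exact (mul_one (Ideal.Quotient.mk (I.map f) a)).symm
  · rw [Ideal.map_le_iff_le_comap]
    intro b hb
    rw [hI, ← annihilator_homology_zero, mem_annihilator_homology_zero] at hb
    rw [Ideal.mem_comap, mem_annihilator_homology_zero]
    intro z
    let W : Submodule S (D.X 0) := LinearMap.range (D.d 1 0).hom
    let q : D.X 0 →ₗ[S] D.X 0 ⧸ W := W.mkQ
    let ι₀ : (complex r).X 0 → D.X 0 := fun m => (1 : S) ⊗ₜ[R, f] m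
    let ι₁ : (complex r).X 1 → D.X 1 := fun m => (1 : S) ⊗ₜ[R, f] m
    have hq : ModuleCat.ofHom (f b • q) = 0 := by
      apply ModuleCat.ExtendScalars.hom_ext
      intro m
      have h1 : ι₀ (b • m) = f b • ι₀ m :=
        map_smul ((ModuleCat.extendRestrictScalarsAdj f).unit.app ((complex r).X 0)).hom b m
      obtain ⟨y, hy⟩ := hb m
      have h2 : (D.d 1 0).hom (ι₁ y) = f b • ι₀ m := by
        rw [← h1, ← hy]
        rfl
      have h3 : q (f b • ι₀ m) = 0 := (Submodule.Quotient.mk_eq_zero _).2 ⟨_, h2⟩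
      rw [map_smul] at h3
      exact h3
    have h3 : f b • q z = 0 := congrArg (fun g => g.hom z) hq
    have h4 : q (f b • z) = 0 := (map_smul q (f b) z).trans h3
    exact (Submodule.Quotient.mk_eq_zero _).1 h4

end Koszul

/-! ### Krull dimension and finiteness of Khovanov–Rozansky homology -/

namespace DirGraph

section Finiteness

variable {V : Type*} {E : Type u} [Fintype E] {G : DirGraph V E} {N : ℕ}
  (ord : Fin N ≃ G.RelIndex)

theorem span_range_incidenceRel_ord :
    Ideal.span (Set.range fun i => G.incidenceRel (ord i)) = G.incidenceIdeal := by
  have : Set.range (fun i => G.incidenceRel (ord i)) = Set.range G.incidenceRel :=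
    ord.surjective.range_comp G.incidenceRel
  rw [this, incidenceIdeal]

theorem annihilator_krHomology_zero :
    Module.annihilator (MvPolynomial E ℤ) (krHomology ord 0) = G.incidenceIdeal :=
  (Koszul.annihilator_homology_zero _).trans (span_range_incidenceRel_ord ord)

theorem annihilator_krHomologyRat_zero :
    Module.annihilator (MvPolynomial E ℚ) (krHomologyRat ord 0) = G.incidenceIdealOver ℚ :=
  (Koszul.annihilator_homology_zero_extendScalars _ _).trans
    (by rw [span_range_incidenceRel_ord, incidenceIdealOver])

theorem incidenceIdeal_le_annihilator (i : ℕ) :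
    G.incidenceIdeal ≤ Module.annihilator (MvPolynomial E ℤ) (krHomology ord i) := by
  rw [← span_range_incidenceRel_ord ord, Ideal.span_le]
  rintro _ ⟨j, rfl⟩
  exact Koszul.mem_annihilator_homology_complex (fun j => G.incidenceRel (ord j)) i j

theorem moduleKrullDim_krHomology [Finite V] :
    moduleKrullDim (MvPolynomial E ℤ) (krHomology ord 0) = G.alpha + 1 := by
  rw [moduleKrullDim, annihilator_krHomology_zero, ← incidenceIdealOver_int,
    ringKrullDim_quotient_incidenceIdealOver,
    IsPrincipalIdealRing.ringKrullDim_eq_one ℤ Int.not_isField, add_comm]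

theorem moduleKrullDim_krHomologyRat [Finite V] :
    moduleKrullDim (MvPolynomial E ℚ) (krHomologyRat ord 0) = G.alpha := by
  rw [moduleKrullDim, annihilator_krHomologyRat_zero, ringKrullDim_quotient_incidenceIdealOver,
    ringKrullDim_eq_zero_of_field, zero_add]

/-- In an acyclic graph every prime ideal containing the incidence ideal contains all variables, so
the variables are nilpotent modulo the incidence ideal. -/
theorem Acyclic.exists_pow_mem [Finite V] (hG : G.Acyclic) :
    ∃ n : ℕ, 1 ≤ n ∧ ∀ x : E, (MvPolynomial.X x : MvPolynomial E ℤ) ^ n ∈ G.incidenceIdeal := by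
  have h : ∀ x : E, (MvPolynomial.X x : MvPolynomial E ℤ) ∈ G.incidenceIdeal.radical := by
    intro x
    rw [Ideal.radical_eq_sInf, Ideal.mem_sInf]
    rintro p ⟨hp, hprime⟩
    rw [← incidenceIdealOver_int] at hp
    obtain ⟨k, c, -, hle⟩ := exists_ker_cycleHom_le hp
    exact hle (cycleHom_X_of_notMem fun i => (hG.false (c i)).elim)
  choose n hn using h
  refine ⟨∑ x, n x + 1, Nat.le_add_left _ _, fun x => ?_⟩
  refine Ideal.pow_mem_of_pow_mem _ (hn x) ?_
  exact (Finset.single_le_sum (fun _ _ => Nat.zero_le _) (Finset.mem_univ x)).trans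
    (Nat.le_succ _)

/-- If some power of every variable lies in an ideal of a polynomial ring over `ℤ`, then the
quotient is integral, hence finite, over `ℤ`. -/
theorem finite_quotient_of_pow_mem {I : Ideal (MvPolynomial E ℤ)} {n : ℕ} (hn : 1 ≤ n)
    (h : ∀ x : E, (MvPolynomial.X x : MvPolynomial E ℤ) ^ n ∈ I) :
    Module.Finite ℤ (MvPolynomial E ℤ ⧸ I) := by
  have : Algebra.IsIntegral ℤ (MvPolynomial E ℤ ⧸ I) := by
    refine ⟨fun a => ?_⟩
    obtain ⟨p, rfl⟩ := Ideal.Quotient.mk_surjective a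
    induction p using MvPolynomial.induction_on with
    | C m => exact isIntegral_algebraMap (R := ℤ) (x := m)
    | add p q hp hq =>
      rw [map_add]
      exact hp.add hq
    | mul_X p x hp =>
      rw [map_mul]
      refine hp.mul (IsIntegral.of_pow hn ?_)
      rw [← map_pow, Ideal.Quotient.eq_zero_iff_mem.2 (h x)]
      exact isIntegral_zero
  exact Algebra.IsIntegral.finite

theorem finite_of_le_annihilator {A : Type*} [CommRing A] {M : Type*} [AddCommGroup M] [Module A M]
    [Module.Finite A M] {I : Ideal A} (hI : I ≤ Module.annihilator A M) [Module.Finite ℤ (A ⧸ I)] :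
    Module.Finite ℤ M := by
  have hM : Module.IsTorsionBySet A M I := fun m a => Module.mem_annihilator.1 (hI a.2) m
  let _ := hM.module
  have : IsScalarTower A (A ⧸ I) M := hM.isScalarTower
  have : Module.Finite (A ⧸ I) M := Module.Finite.of_restrictScalars_finite A _ _
  exact Module.Finite.trans (A ⧸ I) M

theorem finite_krHomology [Module.Finite ℤ (MvPolynomial E ℤ ⧸ G.incidenceIdeal)] (i : ℕ) :
    Module.Finite ℤ (krHomology ord i) := by
  have : Module.Finite (MvPolynomial E ℤ) ((krComplex ord).X i) :=
    inferInstanceAs (Module.Finite _ ((Koszul.complex _).X i))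
  have : Module.Finite (MvPolynomial E ℤ) (krHomology ord i) := homology_finite _ _
  exact finite_of_le_annihilator (incidenceIdeal_le_annihilator ord i)

theorem finite_directSum_krHomology
    [Module.Finite ℤ (MvPolynomial E ℤ ⧸ G.incidenceIdeal)] :
    Module.Finite ℤ (DirectSum ℕ fun i => krHomology ord i) := by
  classical
  have := finite_krHomology ord
  let f : (DirectSum (Fin (N + 1)) fun i => krHomology ord (i : ℕ)) →ₗ[ℤ]
      DirectSum ℕ fun i => krHomology ord i :=
    DirectSum.toModule ℤ _ _ fun i => DirectSum.lof ℤ ℕ (fun i => krHomology ord i) (i : ℕ)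
  refine Module.Finite.of_surjective f ?_
  rw [← LinearMap.range_eq_top, eq_top_iff]
  rintro z -
  induction z using DirectSum.induction_on with
  | zero => exact zero_mem _
  | add x y hx hy => exact add_mem hx hy
  | of i x =>
    by_cases hi : i < N + 1
    · refine ⟨DirectSum.lof ℤ _ (fun i : Fin (N + 1) => krHomology ord (i : ℕ)) ⟨i, hi⟩ x, ?_⟩
      exact DirectSum.toModule_lof ℤ (φ := fun i : Fin (N + 1) =>
        DirectSum.lof ℤ ℕ (fun i => krHomology ord i) (i : ℕ)) ⟨i, hi⟩ x
    · have : Subsingleton ((krComplex ord).X i) :=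
        Koszul.subsingleton_complex_X _ (by omega)
      have : Subsingleton (krHomology ord i) := homology_subsingleton _ _
      rw [Subsingleton.elim x 0, map_zero]
      exact zero_mem _

/-- If the zeroth homology is finite over `ℤ`, then by Cayley–Hamilton every variable satisfies a
monic equation over `ℤ` modulo the incidence ideal; along a directed cycle, this would make a
polynomial variable integral over `ℤ`. -/
theorem acyclic_of_finite (h : Module.Finite ℤ (krHomology ord 0)) : G.Acyclic := by
  refine ⟨fun C => ?_⟩
  have hc : Pairwise fun i j : Fin 1 => Disjoint C.edgeSet C.edgeSet :=
    fun i j hij => absurd (Subsingleton.elim i j) hij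
  let x := C.edge 0
  let φ := Module.toModuleEnd ℤ (S := MvPolynomial E ℤ) (krHomology ord 0)
  obtain ⟨p, hp, hpx⟩ := LinearMap.exists_monic_and_aeval_eq_zero ℤ (φ (MvPolynomial.X x))
  have hmem :
      Polynomial.aeval (MvPolynomial.X x : MvPolynomial E ℤ) p ∈ G.incidenceIdealOver ℤ := by
    rw [incidenceIdealOver_int, ← annihilator_krHomology_zero ord, Module.mem_annihilator]
    intro m
    have h1 : φ (Polynomial.aeval (MvPolynomial.X x : MvPolynomial E ℤ) p) = 0 := by
      rw [← hpx]
      exact (Polynomial.aeval_algHom_apply φ.toIntAlgHom _ p).symm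
    exact congrArg (fun g => g m) h1
  have h2 := incidenceIdealOver_le_ker_cycleHom (c := fun _ : Fin 1 => C) hc hmem
  rw [RingHom.mem_ker, ← Polynomial.aeval_algHom_apply,
    cycleHom_X_of_mem (i := 0) hc ⟨0, rfl⟩] at h2
  refine hp.ne_zero ?_
  by_contra h0
  exact MvPolynomial.transcendental_X ℤ (0 : Fin 1) ⟨p, h0, h2⟩

theorem acyclic_tfae [Finite V] : List.TFAE [
      G.Acyclic,
      Module.Finite ℤ (krHomology ord 0),
      Module.Finite ℤ (DirectSum ℕ fun i => krHomology ord i),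
      ∃ n : ℕ, 1 ≤ n ∧ ∀ x : E, (MvPolynomial.X x : MvPolynomial E ℤ) ^ n ∈ G.incidenceIdeal,
      moduleKrullDim (MvPolynomial E ℤ) (krHomology ord 0) = 1,
      moduleKrullDim (MvPolynomial E ℚ) (krHomologyRat ord 0) = 0] := by
  tfae_have 1 → 4 := Acyclic.exists_pow_mem
  tfae_have 4 → 3 := by
    rintro ⟨n, hn, h⟩
    have := finite_quotient_of_pow_mem hn h
    exact finite_directSum_krHomology ord
  tfae_have 3 → 2 := by
    intro h
    exact Module.Finite.of_surjective (DirectSum.component ℤ ℕ (fun i => krHomology ord i) 0)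
      fun x => ⟨DirectSum.lof ℤ ℕ (fun i => krHomology ord i) 0 x,
        DirectSum.component.lof_self _ _ _⟩
  tfae_have 2 → 1 := acyclic_of_finite ord
  tfae_have 1 ↔ 5 := by
    rw [moduleKrullDim_krHomology, ← alpha_eq_zero_iff]
    exact_mod_cast (by omega : G.alpha = 0 ↔ G.alpha + 1 = 1)
  tfae_have 1 ↔ 6 := by
    rw [moduleKrullDim_krHomologyRat, ← alpha_eq_zero_iff]
    exact_mod_cast Iff.rfl
  tfae_finish

end Finiteness

end DirGraph

/-! ### The Lucchesi–Younger theorem for crossing families -/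

/-- A system of directed cuts: a crossing family of sets of vertices of a directed graph with arc
set `A`, such that every member is entered, but not left, by an arc. -/
structure DicutSystem (V A : Type*) [Fintype V] [DecidableEq V] where
  /-- the tail of an arc -/
  tail : A → V
  /-- the head of an arc -/
  head : A → V
  /-- the family of sets of vertices -/
  cuts : Set (Finset V)
  /-- no arc leaves a member of the family -/
  head_mem : ∀ U ∈ cuts, ∀ a, tail a ∈ U → head a ∈ U
  /-- every member of the family is entered by an arc -/
  exists_enters : ∀ U ∈ cuts, ∃ a, tail a ∉ U ∧ head a ∈ U
  /-- the family is closed under intersections of crossing pairs -/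
  inter_mem : ∀ U ∈ cuts, ∀ W ∈ cuts, (U ∩ W).Nonempty → U ∪ W ≠ Finset.univ → U ∩ W ∈ cuts
  /-- the family is closed under unions of crossing pairs -/
  union_mem : ∀ U ∈ cuts, ∀ W ∈ cuts, (U ∩ W).Nonempty → U ∪ W ≠ Finset.univ → U ∪ W ∈ cuts

namespace DicutSystem

section Families

theorem sum_update_update {ι M X : Type*} [Fintype ι] [DecidableEq ι] [AddCommMonoid M] (g : X → M)
    (u : ι → X) {i j : ι} (hij : i ≠ j) (x y : X) :
    ∑ k, g (Function.update (Function.update u i x) j y k) + (g (u i) + g (u j)) =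
      ∑ k, g (u k) + (g x + g y) := by
  have hj : j ∈ Finset.univ.erase i := Finset.mem_erase.2 ⟨hij.symm, Finset.mem_univ j⟩
  have key : ∀ w : ι → X, ∑ k, g (w k) =
      g (w i) + (g (w j) + ∑ k ∈ (Finset.univ.erase i).erase j, g (w k)) := fun w => by
    rw [← Finset.add_sum_erase _ _ (Finset.mem_univ i), ← Finset.add_sum_erase _ _ hj]
  rw [key, key u, Function.update_self, Function.update_of_ne hij, Function.update_self]
  have : ∑ k ∈ (Finset.univ.erase i).erase j, g (Function.update (Function.update u i x) j y k) =
      ∑ k ∈ (Finset.univ.erase i).erase j, g (u k) := by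
    refine Finset.sum_congr rfl fun k hk => ?_
    simp only [Finset.mem_erase] at hk
    rw [Function.update_of_ne hk.1, Function.update_of_ne hk.2.1]
  rw [this]
  abel

variable {V : Type*}

theorem sq_card_add_sq_card_lt [DecidableEq V] {U W : Finset V} (h : ¬ U ⊆ W) (h' : ¬ W ⊆ U) :
    U.card ^ 2 + W.card ^ 2 < (U ∩ W).card ^ 2 + (U ∪ W).card ^ 2 := by
  have h1 := Finset.card_union_add_card_inter U W
  have h2 : (U ∩ W).card < U.card := Finset.card_lt_card
    ⟨Finset.inter_subset_left, fun hs => h (hs.trans Finset.inter_subset_right)⟩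
  have h3 : (U ∩ W).card < W.card := Finset.card_lt_card
    ⟨Finset.inter_subset_right, fun hs => h' (hs.trans Finset.inter_subset_left)⟩
  obtain ⟨p, hp⟩ := Nat.exists_eq_add_of_lt h2
  obtain ⟨q, hq⟩ := Nat.exists_eq_add_of_lt h3
  have h4 : (U ∪ W).card = (U ∩ W).card + (p + 1) + (q + 1) := by omega
  rw [hp, hq, h4]
  nlinarith

/-- Strict inclusion of the members of a family of sets, where ties are broken by the index. -/
def Below {m : ℕ} (u : Fin m → Finset V) (i k : Fin m) : Prop := u i ⊂ u k ∨ u i = u k ∧ i < k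

variable {m : ℕ} {u : Fin m → Finset V}

theorem Below.trans {i j k : Fin m} (h : Below u i j) (h' : Below u j k) : Below u i k := by
  unfold Below at *
  rcases h with h | ⟨h, hlt⟩ <;> rcases h' with h' | ⟨h', hlt'⟩
  · exact Or.inl (h.trans h')
  · exact Or.inl (h' ▸ h)
  · exact Or.inl (h ▸ h')
  · exact Or.inr ⟨h.trans h', hlt.trans hlt'⟩

theorem not_below_self (i : Fin m) : ¬ Below u i i := by
  rintro (h | h)
  · exact h.ne rfl
  · exact h.2.ne rfl

end Families

variable {V A : Type*} [Fintype V] [DecidableEq V] (D : DicutSystem V A)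

/-- The arc `a` enters the set `U`. -/
def Enters (a : A) (U : Finset V) : Prop := D.tail a ∉ U ∧ D.head a ∈ U

instance (a : A) (U : Finset V) : Decidable (D.Enters a U) :=
  inferInstanceAs (Decidable (_ ∧ _))

/-- The number of members of a finite family of sets that the arc `a` enters. -/
def coverage {ι : Type*} [Fintype ι] (u : ι → Finset V) (a : A) : ℕ :=
  ∑ i, if D.Enters a (u i) then 1 else 0

/-- There is a family of `m` directed cuts (with repetitions) in which every arc `a` occurs at most
`c a` times. -/
def Packs (c : A → ℕ) (m : ℕ) : Prop :=
  ∃ u : Fin m → Finset V, (∀ i, u i ∈ D.cuts) ∧ ∀ a, D.coverage u a ≤ c a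

variable {D}

theorem packs_zero (c : A → ℕ) : D.Packs c 0 :=
  ⟨Fin.elim0, fun i => i.elim0, fun a => by simp [coverage]⟩

theorem Packs.mono {c c' : A → ℕ} {m : ℕ} (h : D.Packs c m) (hc : c ≤ c') : D.Packs c' m :=
  let ⟨u, hu, hcov⟩ := h
  ⟨u, hu, fun a => (hcov a).trans (hc a)⟩

theorem Packs.add {c c' : A → ℕ} {m m' : ℕ} (h : D.Packs c m) (h' : D.Packs c' m') :
    D.Packs (c + c') (m + m') := by
  obtain ⟨u, hu, hcov⟩ := h
  obtain ⟨u', hu', hcov'⟩ := h'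
  refine ⟨Fin.append u u', fun i => ?_, fun a => ?_⟩
  · refine Fin.addCases (fun i => ?_) (fun i => ?_) i
    · rw [Fin.append_left]
      exact hu i
    · rw [Fin.append_right]
      exact hu' i
  · rw [coverage, Fin.sum_univ_add]
    simp only [Fin.append_left, Fin.append_right]
    exact add_le_add (hcov a) (hcov' a)

theorem packs_card_of_finset {ι : Type*} {c : A → ℕ} {u : ι → Finset V} (s : Finset ι)
    (hu : ∀ i ∈ s, u i ∈ D.cuts) (hcov : ∀ a, (s.filter fun i => D.Enters a (u i)).card ≤ c a) :
    D.Packs c s.card := by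
  refine ⟨fun i => u (s.equivFin.symm i), fun i => hu _ (s.equivFin.symm i).2, fun a => ?_⟩
  rw [coverage, Equiv.sum_comp s.equivFin.symm fun i : s => if D.Enters a (u i) then 1 else 0,
    Finset.sum_coe_sort s fun i => if D.Enters a (u i) then 1 else 0, ← Finset.card_filter]
  exact hcov a

section Uncrossing

/-- Two sets of vertices are cross-free if one of the four sets `U \ W`, `W \ U`, `U ∩ W` and
`(U ∪ W)ᶜ` is empty. -/
def CrossFree (U W : Finset V) : Prop :=
  U ⊆ W ∨ W ⊆ U ∨ Disjoint U W ∨ U ∪ W = Finset.univ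

/-- Uncrossing: replacing two crossing sets by their intersection and their union does not change
the coverage, and increases the sum of the squares of the cardinalities. -/
theorem Packs.exists_crossFree {c : A → ℕ} {m : ℕ} (h : D.Packs c m) :
    ∃ u : Fin m → Finset V, (∀ i, u i ∈ D.cuts) ∧ (∀ a, D.coverage u a ≤ c a) ∧
      ∀ i j, CrossFree (u i) (u j) := by
  classical
  obtain ⟨u, hu, hmax⟩ := Set.Finite.exists_maximalFor
    (fun u : Fin m → Finset V => ∑ i, (u i).card ^ 2)
    {u : Fin m → Finset V | (∀ i, u i ∈ D.cuts) ∧ ∀ a, D.coverage u a ≤ c a} (Set.toFinite _) h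
  refine ⟨u, hu.1, hu.2, fun i j => ?_⟩
  by_contra hcross
  unfold CrossFree at hcross
  push Not at hcross
  obtain ⟨h1, h2, h3, h4⟩ := hcross
  have hij : i ≠ j := by
    rintro rfl
    exact h1 subset_rfl
  have hne : (u i ∩ u j).Nonempty := Finset.not_disjoint_iff_nonempty_inter.1 h3
  set u' := Function.update (Function.update u i (u i ∩ u j)) j (u i ∪ u j) with hu'
  have hmem : ∀ k, u' k ∈ D.cuts := by
    intro k
    by_cases hkj : k = j
    · subst hkj
      rw [hu', Function.update_self]
      exact D.union_mem _ (hu.1 i) _ (hu.1 k) hne h4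
    · rw [hu', Function.update_of_ne hkj]
      by_cases hki : k = i
      · subst hki
        rw [Function.update_self]
        exact D.inter_mem _ (hu.1 k) _ (hu.1 j) hne h4
      · rw [Function.update_of_ne hki]
        exact hu.1 k
  have hcov : ∀ a, D.coverage u' a = D.coverage u a := by
    intro a
    have hs := sum_update_update (fun U => if D.Enters a U then 1 else 0) u hij (u i ∩ u j)
      (u i ∪ u j)
    have hmod : ((if D.Enters a (u i ∩ u j) then 1 else 0) +
        if D.Enters a (u i ∪ u j) then 1 else 0) =
        (if D.Enters a (u i) then 1 else 0) + if D.Enters a (u j) then 1 else 0 := by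
      have hi := D.head_mem _ (hu.1 i) a
      have hj := D.head_mem _ (hu.1 j) a
      simp only [Enters, Finset.mem_inter, Finset.mem_union]
      by_cases t1 : D.tail a ∈ u i <;> by_cases t2 : D.tail a ∈ u j <;>
        by_cases t3 : D.head a ∈ u i <;> by_cases t4 : D.head a ∈ u j <;> simp_all
    rw [hmod] at hs
    exact Nat.add_right_cancel hs
  have hlt : ∑ k, (u k).card ^ 2 < ∑ k, (u' k).card ^ 2 := by
    have hs := sum_update_update (fun U : Finset V => U.card ^ 2) u hij (u i ∩ u j) (u i ∪ u j)
    have hsq := sq_card_add_sq_card_lt h1 h2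
    rw [← hu'] at hs
    omega
  exact hlt.not_ge (hmax ⟨hmem, fun a => (hcov a).le.trans (hu.2 a)⟩ hlt.le)

end Uncrossing

section Colouring

variable {m : ℕ} (u : Fin m → Finset V)

/-- The depth whose parity colours a cross-free family. Such a family is represented by a directed
tree whose edges `k` correspond to the members `u k`: the edge `k` separates the vertices of the
tree into an inner side, for the elements of `u k`, and an outer side, and points to the inner one.
The depth of `i` is the number of edges `k` with the tail of the edge `i` on their inner side. -/
def treeDepth (i : Fin m) : ℕ := by
  classical exact (Finset.univ.filter fun k => Below u i k ∨ u i ∪ u k = Finset.univ).card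

variable {u}

variable (hu : ∀ i, u i ∈ D.cuts) (hcf : ∀ i j, CrossFree (u i) (u j))

include hcf in
theorem below_trichotomy {a : A} {i k : Fin m} (hi : D.Enters a (u i)) (hk : D.Enters a (u k)) :
    Below u i k ∨ i = k ∨ Below u k i := by
  unfold Below
  rcases hcf i k with h | h | h | h
  · rcases h.eq_or_ssubset with h | h
    · rcases lt_trichotomy i k with h' | h' | h'
      · exact Or.inl (Or.inr ⟨h, h'⟩)
      · exact Or.inr (Or.inl h')
      · exact Or.inr (Or.inr (Or.inr ⟨h.symm, h'⟩))
    · exact Or.inl (Or.inl h)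
  · rcases h.eq_or_ssubset with h | h
    · rcases lt_trichotomy i k with h' | h' | h'
      · exact Or.inl (Or.inr ⟨h.symm, h'⟩)
      · exact Or.inr (Or.inl h')
      · exact Or.inr (Or.inr (Or.inr ⟨h, h'⟩))
    · exact Or.inr (Or.inr (Or.inl h))
  · exact absurd hk.2 (Finset.disjoint_left.1 h hi.2)
  · have := Finset.mem_univ (D.tail a)
    rw [← h, Finset.mem_union] at this
    exact (this.elim hi.1 hk.1).elim

include hu hcf in
open Classical in
/-- If the arc `a` enters `u i`, then the depth of `i` is a constant depending only on `a`, plus the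
rank of `i` in the chain of members entered by `a`. -/
theorem treeDepth_eq {a : A} {i : Fin m} (hi : D.Enters a (u i)) :
    treeDepth u i = (Finset.univ.filter fun k => D.tail a ∈ u k).card +
      (Finset.univ.filter fun k => D.Enters a (u k) ∧ Below u i k).card := by
  rw [treeDepth, ← Finset.card_union_of_disjoint]
  · congr 1
    ext k
    simp only [Finset.mem_filter, Finset.mem_univ, true_and, Finset.mem_union]
    by_cases hk : D.Enters a (u k)
    · have h1 : u i ∪ u k ≠ Finset.univ := fun h => by
        have := Finset.mem_univ (D.tail a)
        rw [← h, Finset.mem_union] at this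
        exact this.elim hi.1 hk.1
      simp [hk, h1, hk.1]
    -- If `a` does not enter `u k`, then both ends of `a` lie in `u k` or neither does.
    · by_cases ht : D.tail a ∈ u k
      · have hh := D.head_mem _ (hu k) a ht
        simp only [ht, hk, false_and, or_false, iff_true]
        rcases hcf i k with h | h | h | h
        · exact Or.inl (Or.inl ⟨h, fun h' => hi.1 (h' ht)⟩)
        · exact absurd (h ht) hi.1
        · exact absurd hh (Finset.disjoint_left.1 h hi.2)
        · exact Or.inr h
      · have hh : D.head a ∉ u k := fun hh => hk ⟨ht, hh⟩
        simp only [ht, hk, false_and, or_false, iff_false]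
        rintro ((h | h) | h)
        · exact hh (h.subset hi.2)
        · exact hh (h.1 ▸ hi.2)
        · have := Finset.mem_univ (D.tail a)
          rw [← h, Finset.mem_union] at this
          exact this.elim hi.1 ht
  · refine Finset.disjoint_left.2 fun k hk hk' => ?_
    simp only [Finset.mem_filter, Finset.mem_univ, true_and] at hk hk'
    exact hk'.1.1 hk

include hu hcf in
open Classical in
/-- Along the chain of members entered by an arc the depth changes by one from each member to the
next, so each of the two colour classes contains half of the chain. -/
theorem card_filter_treeDepth_le {c : A → ℕ} (hcov : ∀ a, D.coverage u a ≤ 2 * c a) (b : ℕ)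
    (a : A) :
    ((Finset.univ.filter fun i => treeDepth u i % 2 = b).filter fun i => D.Enters a (u i)).card ≤
      c a := by
  let rank : Fin m → ℕ := fun i =>
    (Finset.univ.filter fun k => D.Enters a (u k) ∧ Below u i k).card
  have hrank : ∀ i k, D.Enters a (u k) → Below u i k → rank k < rank i := by
    intro i k hk hik
    refine Finset.card_lt_card ⟨fun l hl => ?_, fun h => ?_⟩
    · simp only [Finset.mem_filter, Finset.mem_univ, true_and] at hl ⊢
      exact ⟨hl.1, hik.trans hl.2⟩
    · have := h (show k ∈ _ by simpa using ⟨hk, hik⟩)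
      simp only [Finset.mem_filter] at this
      exact not_below_self k this.2.2
  have hlt : ∀ i, D.Enters a (u i) → rank i < 2 * c a := by
    intro i hi
    refine lt_of_lt_of_le ?_ (hcov a)
    rw [coverage, ← Finset.card_filter]
    refine Finset.card_lt_card ⟨fun l hl => ?_, fun h => ?_⟩
    · simp only [Finset.mem_filter, Finset.mem_univ, true_and] at hl ⊢
      exact hl.1
    · have := h (show i ∈ _ by simpa using hi)
      simp only [Finset.mem_filter] at this
      exact not_below_self i this.2.2
  rw [← Finset.card_range (c a)]
  -- Two members of the chain with the same colour have ranks that differ by at least two.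
  refine Finset.card_le_card_of_injOn (fun i => rank i / 2) ?_ ?_
  · intro i hi
    simp only [Finset.coe_filter, Finset.mem_filter, Finset.mem_univ, true_and,
      Set.mem_ofPred_eq] at hi
    have := hlt i hi.2
    simp only [Finset.coe_range, Set.mem_Iio]
    omega
  · intro i hi k hk hik
    simp only [Finset.coe_filter, Finset.mem_filter, Finset.mem_univ, true_and,
      Set.mem_ofPred_eq] at hi hk
    have hi' : treeDepth u i = _ + rank i := treeDepth_eq hu hcf hi.2
    have hk' : treeDepth u k = _ + rank k := treeDepth_eq hu hcf hk.2
    have h1 := hi.1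
    have h2 := hk.1
    rw [hi'] at h1
    rw [hk'] at h2
    simp only at hik
    rcases below_trichotomy hcf hi.2 hk.2 with h | h | h
    · have := hrank i k hk.2 h
      omega
    · exact h
    · have := hrank k i hi.2 h
      omega

end Colouring

/-- A family covering every arc `a` at most `2 c(a)` times splits, by the parity of the depth, into
two families covering `a` at most `c(a)` times. -/
theorem Packs.exists_half {c : A → ℕ} {m : ℕ} (h : D.Packs (fun a => 2 * c a) m) :
    ∃ m₁ m₂, m₁ + m₂ = m ∧ D.Packs c m₁ ∧ D.Packs c m₂ := by
  classical
  obtain ⟨u, hu, hcov, hcf⟩ := h.exists_crossFree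
  refine ⟨_, _, ?_, packs_card_of_finset (Finset.univ.filter fun i => treeDepth u i % 2 = 0)
    (fun i _ => hu i) fun a => ?_, packs_card_of_finset
    (Finset.univ.filter fun i => treeDepth u i % 2 = 1) (fun i _ => hu i) fun a => ?_⟩
  · have h := Finset.card_filter_add_card_filter_not (s := (Finset.univ : Finset (Fin m)))
      fun i => treeDepth u i % 2 = 0
    rw [Finset.card_univ, Fintype.card_fin] at h
    refine Eq.trans ?_ h
    congr 2
    ext i
    simp
  · exact card_filter_treeDepth_le hu hcf hcov 0 a
  · exact card_filter_treeDepth_le hu hcf hcov 1 a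

section MinMax

variable [Fintype A]

variable (D) in
/-- The maximal number of directed cuts in a family in which every arc `a` occurs at most `c a`
times. -/
def packingNumber (c : A → ℕ) : ℕ := sSup {m | D.Packs c m}

theorem Packs.le_sum {c : A → ℕ} {m : ℕ} (h : D.Packs c m) : m ≤ ∑ a, c a := by
  obtain ⟨u, hu, hcov⟩ := h
  refine le_trans ?_ (Finset.sum_le_sum fun a _ => hcov a)
  unfold coverage
  rw [Finset.sum_comm]
  refine le_trans (b := ∑ i : Fin m, 1) (by simp) (Finset.sum_le_sum fun i _ => ?_)
  obtain ⟨a, ha⟩ := D.exists_enters _ (hu i)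
  refine le_trans ?_ (Finset.single_le_sum (fun _ _ => Nat.zero_le _) (Finset.mem_univ a))
  rw [if_pos (show D.Enters a (u i) from ha)]

theorem Packs.le_packingNumber {c : A → ℕ} {m : ℕ} (h : D.Packs c m) : m ≤ D.packingNumber c :=
  le_csSup ⟨∑ a, c a, fun _ h => h.le_sum⟩ h

variable (D) in
theorem packs_packingNumber (c : A → ℕ) : D.Packs c (D.packingNumber c) :=
  Nat.sSup_mem (s := {m | D.Packs c m}) ⟨0, packs_zero c⟩ ⟨∑ a, c a, fun _ h => h.le_sum⟩

theorem packingNumber_mono {c c' : A → ℕ} (h : c ≤ c') : D.packingNumber c ≤ D.packingNumber c' :=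
  ((D.packs_packingNumber c).mono h).le_packingNumber

/-- The packing number is midpoint-concave. -/
theorem packingNumber_add_le {c₁ c₂ c : A → ℕ} (h : ∀ a, c₁ a + c₂ a ≤ 2 * c a) :
    D.packingNumber c₁ + D.packingNumber c₂ ≤ 2 * D.packingNumber c := by
  obtain ⟨m₁, m₂, hm, h₁, h₂⟩ :=
    (((D.packs_packingNumber c₁).add (D.packs_packingNumber c₂)).mono h).exists_half
  have := h₁.le_packingNumber
  have := h₂.le_packingNumber
  omega

/-- A concave sequence whose increment at `n` is positive has positive increments before `n`. -/
theorem add_le_of_concave {g : ℕ → ℕ} (hg : ∀ n, g (n + 2) + g n ≤ 2 * g (n + 1)) :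
    ∀ n, g n + 1 ≤ g (n + 1) → g 0 + n ≤ g n
  | 0, _ => le_rfl
  | n + 1, h => by
    have h1 : g (n + 1 + 1) + g n ≤ 2 * g (n + 1) := hg n
    have h2 := add_le_of_concave hg n (by omega)
    omega

/-- The weighted Lucchesi–Younger theorem: some set of arcs meets all directed cuts and has weight
at most the packing number. -/
theorem exists_dijoin (c : A → ℕ) : ∃ J : Finset A,
    (∀ U ∈ D.cuts, ∃ a ∈ J, D.Enters a U) ∧ ∑ a ∈ J, c a ≤ D.packingNumber c := by
  classical
  induction hn : (Finset.univ.filter fun a => c a ≠ 0).card using Nat.strong_induction_on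
    generalizing c with
  | _ n ih =>
  subst hn
  by_cases h0 : D.packingNumber c = 0
  -- Every directed cut contains an arc of weight zero.
  · refine ⟨Finset.univ.filter fun a => c a = 0, fun U hU => ?_, ?_⟩
    · by_contra! hJ
      have : D.Packs c 1 := by
        refine ⟨fun _ => U, fun _ => hU, fun a => ?_⟩
        by_cases ha : D.Enters a U
        · have : c a ≠ 0 := fun h => hJ a (by simpa using h) ha
          simp only [coverage, ha, Finset.univ_unique, if_true, Finset.sum_const,
            Finset.card_singleton, smul_eq_mul, mul_one]
          omega
        · simp [coverage, ha]
      have := this.le_packingNumber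
      omega
    · rw [Finset.sum_eq_zero fun a ha => (Finset.mem_filter.1 ha).2]
      exact Nat.zero_le _
  -- Increase the weights as long as the packing number does not change, up to twice the weights.
  let S : Set (A → ℕ) := {c' | c ≤ c' ∧ (∀ a, c' a ≤ 2 * c a) ∧
    D.packingNumber c' = D.packingNumber c}
  have hfin : S.Finite :=
    (Set.finite_Icc c fun a => 2 * c a).subset fun c' hc' => ⟨hc'.1, hc'.2.1⟩
  obtain ⟨c', ⟨hcc', hc'2, hν⟩, hmax⟩ := hfin.exists_maximalFor (fun c' => ∑ a, c' a) S
    ⟨c, le_rfl, fun a => by omega, rfl⟩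
  obtain ⟨b, hb⟩ : ∃ b, c' b < 2 * c b := by
    by_contra! h
    have h1 : c + c ≤ c' := fun a => by
      have := h a
      simp only [Pi.add_apply]
      omega
    have := (((D.packs_packingNumber c).add (D.packs_packingNumber c)).mono h1).le_packingNumber
    omega
  let g : ℕ → ℕ := fun n => D.packingNumber (Function.update c' b n)
  have hgb : g (c' b) = D.packingNumber c := by
    simp only [g, Function.update_eq_self, hν]
  have hg : ∀ n, g (n + 2) + g n ≤ 2 * g (n + 1) := fun n =>
    packingNumber_add_le fun a => by
      by_cases hab : a = b
      · subst hab
        simp only [Function.update_self]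
        omega
      · simp only [Function.update_of_ne hab]
        omega
  have hgs : g (c' b) + 1 ≤ g (c' b + 1) := by
    have hle : c' ≤ Function.update c' b (c' b + 1) := by
      intro a
      by_cases hab : a = b
      · subst hab
        simp
      · simp [Function.update_of_ne hab]
    have h1 : D.packingNumber c' ≤ g (c' b + 1) := packingNumber_mono hle
    by_contra hlt
    have hlt' : ∑ a, c' a < ∑ a, Function.update c' b (c' b + 1) a :=
      Finset.sum_lt_sum (fun a _ => hle a) ⟨b, Finset.mem_univ b, by simp⟩
    refine hlt'.not_ge (hmax ⟨hcc'.trans hle, fun a => ?_, ?_⟩ hlt'.le)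
    · by_cases hab : a = b
      · subst hab
        rw [Function.update_self]
        omega
      · rw [Function.update_of_ne hab]
        exact hc'2 a
    · change g (c' b + 1) = _
      omega
  -- By concavity, every unit of the weight of `b` contributes to the packing number.
  have hg0 := add_le_of_concave hg (c' b) hgs
  rw [hgb] at hg0
  have hcard : (Finset.univ.filter fun a => Function.update c' b 0 a ≠ 0).card <
      (Finset.univ.filter fun a => c a ≠ 0).card := by
    refine Finset.card_lt_card ⟨fun a ha => ?_, fun h => ?_⟩
    · simp only [Finset.mem_filter, Finset.mem_univ, true_and] at ha ⊢
      by_cases hab : a = b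
      · subst hab
        simp at ha
      · rw [Function.update_of_ne hab] at ha
        have := hc'2 a
        omega
    · have := h (show b ∈ Finset.univ.filter fun a => c a ≠ 0 by
        simp only [Finset.mem_filter, Finset.mem_univ, true_and]
        omega)
      simp at this
  -- So discarding `b` lowers the packing number by at least its weight.
  obtain ⟨J, hJ, hsum⟩ := ih _ hcard (Function.update c' b 0) rfl
  refine ⟨insert b J, fun U hU => ?_, ?_⟩
  · obtain ⟨a, ha, hU⟩ := hJ U hU
    exact ⟨a, Finset.mem_insert_of_mem ha, hU⟩
  · have h1 : ∑ a ∈ insert b J, c a ≤ ∑ a ∈ insert b J, c' a :=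
      Finset.sum_le_sum fun a _ => hcc' a
    have h2 : ∑ a ∈ insert b J, c' a = c' b + ∑ a ∈ J.erase b, c' a := by
      rw [← Finset.add_sum_erase _ _ (Finset.mem_insert_self b J), Finset.erase_insert_eq_erase]
    have h3 : ∑ a ∈ J.erase b, c' a ≤ ∑ a ∈ J, Function.update c' b 0 a := by
      refine le_trans (le_of_eq ?_) (Finset.sum_le_sum_of_subset (Finset.erase_subset b J))
      exact Finset.sum_congr rfl fun a ha => by
        rw [Function.update_of_ne (Finset.ne_of_mem_erase ha)]
    change _ ≤ g 0 at hsum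
    omega

end MinMax

end DicutSystem

/-! ### Planar graphs -/

namespace DirGraph

section DartFunctions

variable {E : Type*} (τ : Equiv.Perm (E × Bool))

theorem flipDart_true (x : E) : flipDart E (x, true) = (x, false) := rfl

theorem flipDart_false (x : E) : flipDart E (x, false) = (x, true) := rfl

theorem flipDart_flipDart (d : E × Bool) : flipDart E (flipDart E d) = d := by
  rcases d with ⟨x, _ | _⟩ <;> rfl

/-- The cycles of a permutation of the darts. -/
abbrev DartCycle : Type _ := Quotient (Equiv.Perm.SameCycle.setoid τ)

/-- The cycle through a dart. -/
def dartCycle (d : E × Bool) : DartCycle τ := Quotient.mk _ d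

theorem dartCycle_surjective : Function.Surjective (dartCycle τ) := Quotient.mk_surjective

theorem dartCycle_eq_iff {d d' : E × Bool} : dartCycle τ d = dartCycle τ d' ↔ τ.SameCycle d d' :=
  Quotient.eq

theorem dartCycle_apply (d : E × Bool) : dartCycle τ (τ d) = dartCycle τ d :=
  (dartCycle_eq_iff τ).2 (Equiv.Perm.sameCycle_apply_left.2 (Equiv.Perm.SameCycle.refl τ d))

/-- The connected components: the orbits on the darts of the group generated by `τ` and the flip. -/
abbrev DartComponent : Type _ :=
  MulAction.orbitRel.Quotient (Subgroup.closure {τ, flipDart E}) (E × Bool)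

theorem apply_eq_of_mem_closure {X : Type*} {φ : E × Bool → X} (h1 : ∀ d, φ (τ d) = φ d)
    (h2 : ∀ d, φ (flipDart E d) = φ d) {g : Equiv.Perm (E × Bool)}
    (hg : g ∈ Subgroup.closure {τ, flipDart E}) : ∀ d, φ (g d) = φ d := by
  induction hg using Subgroup.closure_induction with
  | mem g hg =>
    rcases hg with rfl | rfl
    · exact h1
    · exact h2
  | one => exact fun d => rfl
  | mul g g' _ _ h h' => exact fun d => (h (g' d)).trans (h' d)
  | inv g _ h =>
    exact fun d => by
      rw [← h (g⁻¹ d), ← Equiv.Perm.mul_apply, mul_inv_cancel, Equiv.Perm.one_apply]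

/-- The component containing a cycle of `τ`. -/
def componentOf (q : DartCycle τ) : DartComponent τ :=
  Quotient.lift (fun d => (Quotient.mk _ d : DartComponent τ))
    (fun d d' (h : τ.SameCycle d d') => by
      obtain ⟨i, rfl⟩ := h
      refine (Quotient.sound ?_).symm
      exact ⟨⟨τ ^ i, zpow_mem (Subgroup.subset_closure (by simp)) i⟩, rfl⟩) q

theorem componentOf_surjective : Function.Surjective (componentOf τ) := by
  intro k
  obtain ⟨d, rfl⟩ := Quotient.mk_surjective k
  exact ⟨dartCycle τ d, rfl⟩

theorem componentOf_flip (d : E × Bool) :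
    componentOf τ (dartCycle τ (flipDart E d)) = componentOf τ (dartCycle τ d) :=
  Quotient.sound ⟨⟨flipDart E, Subgroup.subset_closure (by simp)⟩, rfl⟩

/-- A function on the cycles of `τ` with equal values at the two halves of every edge is constant
on components. -/
theorem eq_of_componentOf_eq {X : Type*} {φ : DartCycle τ → X}
    (h : ∀ x, φ (dartCycle τ (x, true)) = φ (dartCycle τ (x, false))) {q q' : DartCycle τ}
    (hq : componentOf τ q = componentOf τ q') : φ q = φ q' := by
  obtain ⟨d, rfl⟩ := dartCycle_surjective τ q
  obtain ⟨d', rfl⟩ := dartCycle_surjective τ q'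
  obtain ⟨⟨g, hg⟩, rfl⟩ := Quotient.exact hq
  refine apply_eq_of_mem_closure τ (φ := fun d => φ (dartCycle τ d)) (fun d => ?_) (fun d => ?_) hg d'
  · rw [dartCycle_apply]
  · rcases d with ⟨x, _ | _⟩
    · exact h x
    · exact (h x).symm

theorem closure_mul_flipDart (σ : Equiv.Perm (E × Bool)) :
    Subgroup.closure {σ * flipDart E, flipDart E} = Subgroup.closure {σ, flipDart E} := by
  have hf : ∀ τ : Equiv.Perm (E × Bool), flipDart E ∈ Subgroup.closure {τ, flipDart E} :=
    fun τ => Subgroup.subset_closure (by simp)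
  have hτ : ∀ τ : Equiv.Perm (E × Bool), τ ∈ Subgroup.closure {τ, flipDart E} :=
    fun τ => Subgroup.subset_closure (by simp)
  apply le_antisymm <;> rw [Subgroup.closure_le, Set.insert_subset_iff, Set.singleton_subset_iff]
  · exact ⟨mul_mem (hτ σ) (hf σ), hf σ⟩
  · have h := mul_mem (hτ (σ * flipDart E)) (inv_mem (hf (σ * flipDart E)))
    rw [mul_inv_cancel_right] at h
    exact ⟨h, hf _⟩

theorem numComponents_mul_flipDart (σ : Equiv.Perm (E × Bool)) :
    numComponents (σ * flipDart E) = numComponents σ := by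
  unfold numComponents
  rw [closure_mul_flipDart]

/-- The coboundary map from functions on the cycles of `τ` to functions on the edges. -/
def coboundary : (DartCycle τ → ℚ) →ₗ[ℚ] (E → ℚ) where
  toFun g x := g (dartCycle τ (x, true)) - g (dartCycle τ (x, false))
  map_add' g g' := by
    ext x
    simp only [Pi.add_apply]
    ring
  map_smul' a g := by
    ext x
    simp only [Pi.smul_apply, smul_eq_mul, RingHom.id_apply]
    ring

theorem coboundary_apply (g : DartCycle τ → ℚ) (x : E) :
    coboundary τ g x = g (dartCycle τ (x, true)) - g (dartCycle τ (x, false)) := rfl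

/-- The kernel of the coboundary map consists of the locally constant functions. -/
theorem range_funLeft_componentOf :
    LinearMap.range (LinearMap.funLeft ℚ ℚ (componentOf τ)) = LinearMap.ker (coboundary τ) := by
  ext g
  constructor
  · rintro ⟨k, rfl⟩
    rw [LinearMap.mem_ker]
    ext x
    rw [coboundary_apply, LinearMap.funLeft_apply, LinearMap.funLeft_apply, ← flipDart_false,
      componentOf_flip]
    exact sub_self _
  · intro hg
    refine ⟨fun k => g (Function.surjInv (componentOf_surjective τ) k), ?_⟩
    ext q
    rw [LinearMap.funLeft_apply]
    refine eq_of_componentOf_eq τ (fun x => ?_) (Function.surjInv_eq _ _)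
    exact sub_eq_zero.1 (congrFun (LinearMap.mem_ker.1 hg) x)

theorem finrank_range_coboundary [Finite E] :
    Module.finrank ℚ (LinearMap.range (coboundary τ)) + numComponents τ = numCycles τ := by
  have := Fintype.ofFinite (DartCycle τ)
  have := Fintype.ofFinite (DartComponent τ)
  have h1 := LinearMap.finrank_range_add_finrank_ker (coboundary τ)
  rw [← range_funLeft_componentOf, LinearMap.finrank_range_of_inj
    (LinearMap.funLeft_injective_of_surjective ℚ ℚ _ (componentOf_surjective τ)),
    Module.finrank_fintype_fun_eq_card, Module.finrank_fintype_fun_eq_card,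
    ← Nat.card_eq_fintype_card, ← Nat.card_eq_fintype_card] at h1
  exact h1

/-- Coboundaries of functions on the vertices are orthogonal to coboundaries of functions on the
faces. -/
theorem coboundary_dotProduct_coboundary [Fintype E] (σ : Equiv.Perm (E × Bool))
    (p : DartCycle σ → ℚ) (g : DartCycle (σ * flipDart E) → ℚ) :
    coboundary σ p ⬝ᵥ coboundary (σ * flipDart E) g = 0 := by
  -- Sum over the darts; the permutation `σ * flip` fixes `Q`, so `Q` agrees at `flip d` and `σ d`.
  let P : E × Bool → ℚ := fun d => p (dartCycle σ d)
  let Q : E × Bool → ℚ := fun d => g (dartCycle _ d)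
  have hP : ∀ d, P (σ d) = P d := fun d => congrArg p (dartCycle_apply σ d)
  have hQ : ∀ d, Q (flipDart E d) = Q (σ d) := fun d => by
    refine (congrArg g (dartCycle_apply _ (flipDart E d))).symm.trans ?_
    rw [Equiv.Perm.mul_apply, flipDart_flipDart]
  have h1 : coboundary σ p ⬝ᵥ coboundary (σ * flipDart E) g =
      ∑ d, P d * (Q d - Q (flipDart E d)) := by
    rw [Fintype.sum_prod_type]
    refine Finset.sum_congr rfl fun x _ => ?_
    rw [Fintype.sum_bool, flipDart_true, flipDart_false, coboundary_apply, coboundary_apply]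
    simp only [P, Q]
    ring
  have h2 : ∑ d, P d * Q (flipDart E d) = ∑ d, P d * Q d := by
    rw [← Equiv.sum_comp σ fun d => P d * Q d]
    exact Finset.sum_congr rfl fun d _ => by rw [hQ, hP]
  rw [h1]
  simp only [mul_sub, Finset.sum_sub_distrib]
  rw [h2, sub_self]

/-- By Euler's formula, in a planar embedding the coboundaries of functions on the faces are all
functions on the edges that are orthogonal to the coboundaries of functions on the vertices. -/
theorem mem_range_coboundary_of_planar [Fintype E] {σ : Equiv.Perm (E × Bool)}
    (hσ : numCycles σ + numCycles (σ * flipDart E) = Nat.card E + 2 * numComponents σ)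
    {h : E → ℚ} (hh : ∀ p, coboundary σ p ⬝ᵥ h = 0) :
    ∃ g, coboundary (σ * flipDart E) g = h := by
  classical
  let W := LinearMap.range (coboundary σ)
  let U := LinearMap.range (coboundary (σ * flipDart E))
  let Φ := dotProductEquiv ℚ E
  have hle : U.map Φ.toLinearMap ≤ W.dualAnnihilator := by
    rintro _ ⟨_, ⟨g, rfl⟩, rfl⟩
    rw [Submodule.mem_dualAnnihilator]
    rintro _ ⟨p, rfl⟩
    change coboundary (σ * flipDart E) g ⬝ᵥ coboundary σ p = 0
    rw [dotProduct_comm, coboundary_dotProduct_coboundary]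
  -- The two sides have dimensions `f - c` and `e - (v - c)`.
  have hdim : Module.finrank ℚ (U.map Φ.toLinearMap) = Module.finrank ℚ W.dualAnnihilator := by
    have h1 := Subspace.finrank_add_finrank_dualAnnihilator_eq W
    have h2 := finrank_range_coboundary σ
    have h3 := finrank_range_coboundary (σ * flipDart E)
    rw [numComponents_mul_flipDart] at h3
    rw [Module.finrank_fintype_fun_eq_card] at h1
    rw [Nat.card_eq_fintype_card] at hσ
    have h4 : Module.finrank ℚ (U.map Φ.toLinearMap) = Module.finrank ℚ U :=
      LinearEquiv.finrank_map_eq Φ U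
    change Module.finrank ℚ W + _ = _ at h2
    change Module.finrank ℚ U + _ = _ at h3
    omega
  have heq := Submodule.eq_of_le_of_finrank_eq hle hdim
  have hmem : Φ h ∈ W.dualAnnihilator := by
    rw [Submodule.mem_dualAnnihilator]
    rintro _ ⟨p, rfl⟩
    change h ⬝ᵥ coboundary σ p = 0
    rw [dotProduct_comm, hh]
  rw [← heq] at hmem
  obtain ⟨_, ⟨g, rfl⟩, hg⟩ := hmem
  exact ⟨g, Φ.injective hg⟩

end DartFunctions

section DualGraph

variable {E : Type*} (τ : Equiv.Perm (E × Bool))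

/-- A base point in each component. -/
def basePoint (k : DartComponent τ) : DartCycle τ := Function.surjInv (componentOf_surjective τ) k

theorem componentOf_basePoint (k : DartComponent τ) : componentOf τ (basePoint τ k) = k :=
  Function.surjInv_eq _ _

instance [Fintype E] : Fintype (DartCycle τ) := Fintype.ofFinite _

instance : DecidableEq (DartCycle τ) := Classical.decEq _

variable [Fintype E]

/-- The directed cuts of the graph whose vertices are the cycles of `τ` and whose arcs lead from the
cycle through the terminal half of an edge to the cycle through its initial half. For
`τ = σ * flip`, this is the dual graph of the embedding given by `σ`. In case it is disconnected, its
components are glued together at their base points: a cut contains all base points or none. -/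
def dualCuts : DicutSystem (DartCycle τ) E where
  tail x := dartCycle τ (x, false)
  head x := dartCycle τ (x, true)
  cuts := {U | U.Nonempty ∧ U ≠ Finset.univ ∧
    (∀ x, dartCycle τ (x, false) ∈ U → dartCycle τ (x, true) ∈ U) ∧
    ∀ k k', basePoint τ k ∈ U → basePoint τ k' ∈ U}
  head_mem _ hU := hU.2.2.1
  exists_enters := by
    rintro U ⟨⟨q, hq⟩, hne, hclosed, hbase⟩
    by_contra! h
    have hiff : ∀ x, (dartCycle τ (x, true) ∈ U) = (dartCycle τ (x, false) ∈ U) := fun x =>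
      propext ⟨fun hx => by_contra fun hx' => h x hx' hx, hclosed x⟩
    have hb : ∀ q, (q ∈ U) = (basePoint τ (componentOf τ q) ∈ U) := fun q =>
      eq_of_componentOf_eq τ (φ := fun q => q ∈ U) hiff (componentOf_basePoint τ _).symm
    refine hne (Finset.eq_univ_iff_forall.2 fun q' => ?_)
    rw [hb]
    rw [hb] at hq
    exact hbase _ _ hq
  inter_mem U hU W hW hne _ := by
    refine ⟨hne, fun h => hU.2.1 ?_, fun x => ?_, fun k k' => ?_⟩
    · exact Finset.eq_univ_iff_forall.2 fun q =>
        (Finset.mem_inter.1 (h ▸ Finset.mem_univ q)).1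
    · simp only [Finset.mem_inter]
      exact And.imp (hU.2.2.1 x) (hW.2.2.1 x)
    · simp only [Finset.mem_inter]
      exact And.imp (hU.2.2.2 k k') (hW.2.2.2 k k')
  union_mem U hU W hW _ hne := by
    refine ⟨hU.1.mono Finset.subset_union_left, hne, fun x => ?_, fun k k' => ?_⟩
    · simp only [Finset.mem_union]
      exact Or.imp (hU.2.2.1 x) (hW.2.2.1 x)
    · simp only [Finset.mem_union]
      exact Or.imp (hU.2.2.2 k k') (hW.2.2.2 k k')

end DualGraph

section Planar

variable {V E : Type*} [Fintype E] {G : DirGraph V E} {σ : Equiv.Perm (E × Bool)}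

/-- The indicator function of a directed cycle is orthogonal to the coboundaries of functions on
the vertices. -/
theorem DirCycle.coboundary_dotProduct (hσ : G.IsRotationSystem σ) [DecidableEq E] (c : G.DirCycle)
    (p : DartCycle σ → ℚ) : (coboundary σ p ⬝ᵥ fun x => if x ∈ c.edges then 1 else 0) = 0 := by
  have h1 : (coboundary σ p ⬝ᵥ fun x => if x ∈ c.edges then 1 else 0) =
      ∑ i, coboundary σ p (c.edge i) := by
    simp only [dotProduct, mul_ite, mul_one, mul_zero]
    rw [Finset.sum_ite_mem, Finset.univ_inter, DirCycle.edges,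
      Finset.sum_image fun i _ j _ h => c.edge_injective h]
  have h2 : ∀ i, dartCycle σ (c.edge i, false) = dartCycle σ (c.edge (i + 1), true) := fun i =>
    (dartCycle_eq_iff σ).2 ((hσ _ _).2 (c.tgt_eq i))
  rw [h1]
  simp only [coboundary_apply, h2, Finset.sum_sub_distrib]
  exact sub_eq_zero.2 (Equiv.sum_comp (Equiv.addRight (1 : Fin (c.n + 1)))
    fun i => p (dartCycle σ (c.edge i, true))).symm

open Classical in
/-- A directed cut of the dual graph is a balanced set of edges. -/
theorem balanced_of_mem_dualCuts (hσ : G.IsRotationSystem σ)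
    {U : Finset (DartCycle (σ * flipDart E))} (hU : U ∈ (dualCuts (σ * flipDart E)).cuts) :
    G.Balanced (Finset.univ.filter fun x => (dualCuts (σ * flipDart E)).Enters x U) := by
  intro v
  let p : DartCycle σ → ℚ := Quotient.lift (fun d => if G.dartVertex d = v then 1 else 0)
    fun d d' (h : σ.SameCycle d d') => by rw [(hσ d d').1 h]
  have hp : ∀ x, coboundary σ p x =
      (if G.src x = v then 1 else 0) - if G.tgt x = v then 1 else 0 := fun x => rfl
  have hg : ∀ x, coboundary (σ * flipDart E) (fun q => if q ∈ U then 1 else 0) x =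
      if (dualCuts (σ * flipDart E)).Enters x U then 1 else 0 := by
    intro x
    have hx := hU.2.2.1 x
    rw [coboundary_apply]
    change _ = if dartCycle _ (x, false) ∉ U ∧ dartCycle _ (x, true) ∈ U then _ else _
    by_cases h1 : dartCycle _ (x, false) ∈ U
    · simp [h1, hx h1]
    · by_cases h2 : dartCycle _ (x, true) ∈ U <;> simp [h1, h2]
  have h : ∑ x, coboundary σ p x *
      coboundary (σ * flipDart E) (fun q => if q ∈ U then 1 else 0) x = 0 :=
    coboundary_dotProduct_coboundary σ p _
  simp only [hp, hg, mul_ite, mul_one, mul_zero] at h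
  rw [← Finset.sum_filter, Finset.sum_sub_distrib, sub_eq_zero, Finset.sum_boole,
    Finset.sum_boole] at h
  exact_mod_cast h

/-- In a planar embedding, every directed cycle contains a directed cut of the dual graph: the
indicator function of the cycle is the coboundary of a function on the faces, and any level set of
this function gives a cut. -/
theorem DirCycle.exists_dualCut (hσ : G.IsRotationSystem σ)
    (hE : numCycles σ + numCycles (σ * flipDart E) = Nat.card E + 2 * numComponents σ)
    (c : G.DirCycle) : ∃ U ∈ (dualCuts (σ * flipDart E)).cuts,
      ∀ x, (dualCuts (σ * flipDart E)).Enters x U → x ∈ c.edgeSet := by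
  classical
  obtain ⟨g, hg⟩ := mem_range_coboundary_of_planar hE (c.coboundary_dotProduct hσ)
  -- Normalize the potential to vanish at the base points.
  let f : DartCycle (σ * flipDart E) → ℚ := fun q => g q - g (basePoint _ (componentOf _ q))
  have hf : ∀ x, f (dartCycle _ (x, true)) - f (dartCycle _ (x, false)) =
      if x ∈ c.edges then 1 else 0 := by
    intro x
    rw [← congrFun hg x, coboundary_apply]
    simp only [f, ← flipDart_false, componentOf_flip]
    ring
  have hbase : ∀ k, f (basePoint _ k) = 0 := fun k => by
    simp only [f, componentOf_basePoint, sub_self]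
  obtain ⟨x, hx⟩ := c.edgeSet_nonempty
  have hfx := hf x
  rw [if_pos (DirCycle.mem_edges.2 hx)] at hfx
  refine ⟨Finset.univ.filter fun q => f (dartCycle _ (x, true)) ≤ f q,
    ⟨⟨dartCycle _ (x, true), by simp⟩, fun h => ?_, fun y hy => ?_, fun k k' => ?_⟩, fun y hy => ?_⟩
  · have := h ▸ Finset.mem_univ (dartCycle _ (x, false))
    simp only [Finset.mem_filter, Finset.mem_univ, true_and] at this
    linarith
  · simp only [Finset.mem_filter, Finset.mem_univ, true_and] at hy ⊢
    have := hf y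
    split_ifs at this <;> linarith
  · simp only [Finset.mem_filter, Finset.mem_univ, true_and, hbase]
    exact id
  · have h1 : dartCycle _ (y, false) ∉ _ := hy.1
    have h2 : dartCycle _ (y, true) ∈ _ := hy.2
    simp only [Finset.mem_filter, Finset.mem_univ, true_and] at h1 h2
    by_contra hyc
    have := hf y
    rw [if_neg fun h => hyc (DirCycle.mem_edges.1 h)] at this
    linarith

/-- The Lucchesi–Younger theorem for the dual graph: in a planar graph there are as many disjoint
directed cycles as edges needed to meet all directed cycles. -/
theorem IsPlanar.beta_le_alpha [Finite V] (hG : G.IsPlanar) : G.beta ≤ G.alpha := by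
  classical
  obtain ⟨σ, hσ, hE⟩ := hG
  obtain ⟨J, hJ, hcard⟩ := (dualCuts (σ * flipDart E)).exists_dijoin fun _ => 1
  have h1 : G.beta ≤ J.card := by
    refine beta_le (deleteEdges_acyclic_iff.2 fun c => ?_)
    obtain ⟨U, hU, hUc⟩ := c.exists_dualCut hσ hE
    obtain ⟨x, hx, hxU⟩ := hJ U hU
    exact ⟨x, hx, hUc x hxU⟩
  obtain ⟨u, hu, hcov⟩ := (dualCuts (σ * flipDart E)).packs_packingNumber fun _ => 1
  have hcyc : ∀ i, ∃ c : G.DirCycle, c.edgeSet ⊆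
      (Finset.univ.filter fun x => (dualCuts (σ * flipDart E)).Enters x (u i) : Finset E) := by
    intro i
    refine (balanced_of_mem_dualCuts hσ (hu i)).exists_dirCycle_subset ?_
    obtain ⟨x, hx⟩ := (dualCuts (σ * flipDart E)).exists_enters _ (hu i)
    exact ⟨x, Finset.mem_filter.2 ⟨Finset.mem_univ x, hx⟩⟩
  choose c hc using hcyc
  have h2 : (dualCuts (σ * flipDart E)).packingNumber (fun _ => 1) ≤ G.alpha := by
    refine le_alpha (c := c) fun i j hij => Set.disjoint_left.2 fun x hxi hxj => ?_
    have h3 := hcov x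
    rw [DicutSystem.coverage, ← Finset.card_filter] at h3
    refine hij (Finset.card_le_one.1 h3 i ?_ j ?_)
    · simpa using hc i hxi
    · simpa using hc j hxj
  rw [Finset.sum_const, smul_eq_mul, mul_one] at hcard
  exact h1.trans (hcard.trans h2)

end Planar

end DirGraph

theorem mainTheorem2 {V : Type*} {E : Type*} [Finite V] [Fintype E] (G : DirGraph V E)
    {N : ℕ} (ord : Fin N ≃ G.RelIndex) :
    List.TFAE [
      G.Acyclic,
      Module.Finite ℤ (DirGraph.krHomology ord 0),
      Module.Finite ℤ (DirectSum ℕ fun i => DirGraph.krHomology ord i),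
      ∃ n : ℕ, 1 ≤ n ∧ ∀ x : E, (MvPolynomial.X x : MvPolynomial E ℤ) ^ n ∈ G.incidenceIdeal,
      moduleKrullDim (MvPolynomial E ℤ) (DirGraph.krHomology ord 0) = 1,
      moduleKrullDim (MvPolynomial E ℚ) (DirGraph.krHomologyRat ord 0) = 0] ∧
    ((G.alpha : WithBot ℕ∞) = moduleKrullDim (MvPolynomial E ℚ) (DirGraph.krHomologyRat ord 0) ∧
      moduleKrullDim (MvPolynomial E ℚ) (DirGraph.krHomologyRat ord 0) + 1 ≤
        moduleKrullDim (MvPolynomial E ℤ) (DirGraph.krHomology ord 0) ∧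
      moduleKrullDim (MvPolynomial E ℤ) (DirGraph.krHomology ord 0) ≤
        (G.beta : WithBot ℕ∞) + 1) ∧
    (G.IsPlanar →
      (G.alpha : WithBot ℕ∞) = moduleKrullDim (MvPolynomial E ℚ) (DirGraph.krHomologyRat ord 0) ∧
      moduleKrullDim (MvPolynomial E ℚ) (DirGraph.krHomologyRat ord 0) + 1 =
        moduleKrullDim (MvPolynomial E ℤ) (DirGraph.krHomology ord 0) ∧
      moduleKrullDim (MvPolynomial E ℤ) (DirGraph.krHomology ord 0) =
        (G.beta : WithBot ℕ∞) + 1) := by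
  refine ⟨DirGraph.acyclic_tfae ord, ?_, fun hG => ?_⟩
  · rw [DirGraph.moduleKrullDim_krHomology, DirGraph.moduleKrullDim_krHomologyRat]
    refine ⟨rfl, le_rfl, ?_⟩
    exact_mod_cast Nat.succ_le_succ G.alpha_le_beta
  · rw [DirGraph.moduleKrullDim_krHomology, DirGraph.moduleKrullDim_krHomologyRat,
      le_antisymm G.alpha_le_beta hG.beta_le_alpha]
    exact ⟨rfl, rfl, rfl⟩

end
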